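/- For $\theta\in\mathbb R$ let $\mathbb C_\theta=\{s\in\mathbb C:\operatorname{Re}s>\theta\}$. A convergent Dirichlet series is an analytic function $\phi\colon\mathbb C_0\to\mathbb C$ that can be written $\phi(s)=\sum_{n\ge1}a_n n^{-s}$ for $\operatorname{Re}s$ large enough. Let $\mathcal A^+$ be the Banach space of all functions $f\colon\mathbb C_0\to\mathbb C$ of the form $f(s)=\sum_{n\ge1}a_n n^{-s}$ with $\|f\|_{\mathcal A^+}:=\sum_{n\ge1}|a_n|<\infty$. For $1\le q<\infty$ let $\mathscr H^q$ be the space of all convergent Dirichlet series $\phi=\sum_n a_nn^{-s}$ whose Bohr lift $\sum_\alpha a_{n(\alpha)}z^\alpha$, where $n(\alpha)=\prod_j p_j^{\alpha_j}$ and $p_1<p_2<\cdots$ are the primes, is the Fourier series of a function in the Hardy space $H^q(\mathbb T^\infty)$, i.e. of a function $F\in L^q(\mathbb T^\infty)$ (normalized Haar measure) whose Fourier coefficients vanish at all multi-indices having a negative entry. Theorem. For every $p\in(1,\infty)$ there exists a convergent Dirichlet series $\phi$ such that $\phi\in\mathscr H^q$ for all $q\in[1,p)$ but $\phi\notin\mathscr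 H^p$, and such that $\phi$ maps $\mathbb C_0$ into $\mathbb C_0$ and induces a bounded composition operator $C_\phi\colon\mathcal A^+\to\mathcal A^+$, $C_\phi(f)=f\circ\phi$. Moreover, $C_\phi$ is compact and absolutely summing, i.e. there is a constant $K>0$ such that for all finite families $x_1,\dots,x_n$ in $\mathcal A^+$ $$\sum_{k=1}^n\|C_\phi(x_k)\|\le K\sup_{\|\xi\|_{(\mathcal A^+)^*}\le1}\ \sum_{k=1}^n|\xi(x_k)|.$$ -/

import Mathlib

open MeasureTheory Set Filter

noncomputable section

/-- The open right half-plane `ℂ₀ = {s | Re s > 0}`. -/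
def rightHalfPlane : Set ℂ := {s | 0 < s.re}

/-! ### The Wiener algebra of absolutely convergent Dirichlet series -/

/-- `a` is a sequence of coefficients `(aₙ)`, `n ≥ 1`, with `∑ |aₙ| < ∞` and
`f s = ∑ aₙ n⁻ˢ` on `ℂ₀`. Index `0` plays no role and is normalised by `a 0 = 0`. -/
def IsWienerExpansion (f : rightHalfPlane → ℂ) (a : ℕ → ℂ) : Prop :=
  a 0 = 0 ∧ Summable (fun n => ‖a n‖) ∧ ∀ s : rightHalfPlane, LSeriesHasSum a s (f s)

theorem lseriesSummable_of_summable_norm {a : ℕ → ℂ} (ha : Summable (fun n => ‖a n‖))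
    {s : ℂ} (hs : 0 ≤ s.re) : LSeriesSummable a s := by
  refine Summable.of_norm_bounded ha (fun n => ?_)
  rcases eq_or_ne n 0 with rfl | hn
  · simp
  · rw [LSeries.norm_term_eq, if_neg hn]
    refine div_le_self (norm_nonneg _) (Real.one_le_rpow ?_ hs)
    exact_mod_cast Nat.one_le_iff_ne_zero.mpr hn

theorem IsWienerExpansion.unique {f : rightHalfPlane → ℂ} {a b : ℕ → ℂ}
    (ha : IsWienerExpansion f a) (hb : IsWienerExpansion f b) : a = b := by
  have key : ∀ {c : ℕ → ℂ}, IsWienerExpansion f c → LSeries.abscissaOfAbsConv c < ⊤ := by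
    intro c hc
    refine lt_of_le_of_lt (LSeriesSummable.abscissaOfAbsConv_le (s := 0)
      (lseriesSummable_of_summable_norm hc.2.1 (by simp))) ?_
    exact EReal.coe_lt_top _
  funext n
  rcases eq_or_ne n 0 with rfl | hn
  · rw [ha.1, hb.1]
  · refine LSeries.eq_of_LSeries_eventually_eq (key ha) (key hb) ?_ hn
    filter_upwards [eventually_gt_atTop (0 : ℝ)] with x hx
    have hx' : (x : ℂ) ∈ rightHalfPlane := by simpa [rightHalfPlane] using hx
    exact ((ha.2.2 ⟨x, hx'⟩).LSeries_eq).trans ((hb.2.2 ⟨x, hx'⟩).LSeries_eq).symm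

theorem IsWienerExpansion.zero : IsWienerExpansion 0 0 :=
  ⟨rfl, by simp, fun s => by
    have h : LSeries.term 0 (s : ℂ) = fun _ => 0 := funext fun n => by simp [LSeries.term_def]
    rw [LSeriesHasSum, h]
    exact hasSum_zero⟩

theorem IsWienerExpansion.add {f g : rightHalfPlane → ℂ} {a b : ℕ → ℂ}
    (ha : IsWienerExpansion f a) (hb : IsWienerExpansion g b) :
    IsWienerExpansion (f + g) (a + b) :=
  ⟨by simp [ha.1, hb.1],
    Summable.of_nonneg_of_le (fun _ => norm_nonneg _) (fun _ => norm_add_le _ _)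
      (ha.2.1.add hb.2.1),
    fun s => (ha.2.2 s).add (hb.2.2 s)⟩

theorem IsWienerExpansion.smul {f : rightHalfPlane → ℂ} {a : ℕ → ℂ} (c : ℂ)
    (ha : IsWienerExpansion f a) : IsWienerExpansion (c • f) (c • a) :=
  ⟨by simp [ha.1], by simpa [norm_mul] using ha.2.1.mul_left ‖c‖, fun s => (ha.2.2 s).smul c⟩

/-- The vector space of all functions on `ℂ₀` that are sums of a Dirichlet series with absolutely
summable coefficients. -/
def wienerSubmodule : Submodule ℂ (rightHalfPlane → ℂ) where
  carrier := {f | ∃ a : ℕ → ℂ, IsWienerExpansion f a}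
  zero_mem' := ⟨0, .zero⟩
  add_mem' := fun ⟨a, ha⟩ ⟨b, hb⟩ => ⟨a + b, ha.add hb⟩
  smul_mem' := fun c _ ⟨a, ha⟩ => ⟨c • a, ha.smul c⟩

/-- The Wiener algebra `𝒜⁺` of Dirichlet series, as a type of functions on `ℂ₀`. A type of its own,
so that its topology is that of the norm below and not pointwise convergence. -/
def WienerAlgebra : Type := wienerSubmodule

namespace WienerAlgebra

instance : AddCommGroup WienerAlgebra := inferInstanceAs (AddCommGroup wienerSubmodule)

instance : Module ℂ WienerAlgebra := inferInstanceAs (Module ℂ wienerSubmodule)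

instance : CoeFun WienerAlgebra (fun _ => rightHalfPlane → ℂ) := ⟨fun f => f.1⟩

/-- The coefficients of an element of `𝒜⁺`. -/
def coeff (f : WienerAlgebra) : ℕ → ℂ := f.2.choose

theorem isWienerExpansion_coeff (f : WienerAlgebra) : IsWienerExpansion f f.coeff :=
  f.2.choose_spec

theorem coeff_eq (f : WienerAlgebra) {a : ℕ → ℂ} (ha : IsWienerExpansion f a) : f.coeff = a :=
  f.isWienerExpansion_coeff.unique ha

/-- The norm `‖f‖ = ∑ |aₙ|` of `𝒜⁺`. -/
instance : Norm WienerAlgebra := ⟨fun f => ∑' n, ‖f.coeff n‖⟩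

theorem norm_def (f : WienerAlgebra) : ‖f‖ = ∑' n, ‖f.coeff n‖ := rfl

theorem coeff_add (f g : WienerAlgebra) : (f + g).coeff = f.coeff + g.coeff :=
  coeff_eq _ (f.isWienerExpansion_coeff.add g.isWienerExpansion_coeff)

theorem coeff_smul (c : ℂ) (f : WienerAlgebra) : (c • f).coeff = c • f.coeff :=
  coeff_eq _ (f.isWienerExpansion_coeff.smul c)

theorem coeff_zero : (0 : WienerAlgebra).coeff = 0 := coeff_eq _ .zero

theorem normedSpaceCore : NormedSpace.Core ℂ WienerAlgebra where
  norm_nonneg f := tsum_nonneg fun _ => norm_nonneg _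
  norm_smul c f := by
    simp only [norm_def, coeff_smul, Pi.smul_apply, norm_smul, tsum_mul_left]
  norm_triangle f g := by
    have hf := f.isWienerExpansion_coeff.2.1
    have hg := g.isWienerExpansion_coeff.2.1
    simp only [norm_def, coeff_add, Pi.add_apply]
    rw [← hf.tsum_add hg]
    exact ((f.isWienerExpansion_coeff.add g.isWienerExpansion_coeff).2.1).tsum_le_tsum
      (fun _ => norm_add_le _ _) (hf.add hg)
  norm_eq_zero_iff f := by
    constructor
    · intro h
      have h0 : f.coeff = 0 := by
        have := (f.isWienerExpansion_coeff.2.1.hasSum_iff.mpr h)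
        rw [hasSum_zero_iff_of_nonneg (fun _ => norm_nonneg _)] at this
        funext n
        simpa using congrFun this n
      refine Subtype.ext (funext fun s => ?_)
      have hs := f.isWienerExpansion_coeff.2.2 s
      rw [h0] at hs
      exact hs.unique (IsWienerExpansion.zero.2.2 s)
    · rintro rfl
      simp [norm_def, coeff_zero]

instance : NormedAddCommGroup WienerAlgebra := NormedAddCommGroup.ofCore normedSpaceCore

instance : NormedSpace ℂ WienerAlgebra := NormedSpace.ofCore normedSpaceCore

end WienerAlgebra

/-- `T` is the composition operator `f ↦ f ∘ φ` on `𝒜⁺`; this includes `φ(ℂ₀) ⊆ ℂ₀`. -/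
def IsCompositionOperator (φ : ℂ → ℂ) (T : WienerAlgebra →L[ℂ] WienerAlgebra) : Prop :=
  ∃ hφ : MapsTo φ rightHalfPlane rightHalfPlane,
    ∀ (f : WienerAlgebra) (s : rightHalfPlane), (T f) s = f ⟨φ s, hφ s.2⟩

/-! ### Absolutely summing operators -/

/-- A bounded operator is absolutely summing (`1`-summing) if, for some constant `K > 0`,
`∑ ‖T xₖ‖ ≤ K sup_ξ ∑ |ξ(xₖ)|` for all finite families, where `ξ` runs over the closed unit ball
of the dual space. -/
def IsAbsolutelySumming {X Y : Type*} [NormedAddCommGroup X] [NormedSpace ℂ X]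
    [NormedAddCommGroup Y] [NormedSpace ℂ Y] (T : X →L[ℂ] Y) : Prop :=
  ∃ K : ℝ, 0 < K ∧ ∀ (n : ℕ) (x : Fin n → X),
    ∑ k, ‖T (x k)‖ ≤ K * ⨆ ξ : Metric.closedBall (0 : StrongDual ℂ X) 1, ∑ k, ‖ξ.1 (x k)‖

/-! ### Convergent Dirichlet series and their Hardy spaces -/

/-- `φ` is analytic on `ℂ₀` and `φ s = ∑ aₙ n⁻ˢ` when `Re s` is large enough. Only the values of
`φ` on `ℂ₀` matter. -/
def HasDirichletExpansion (φ : ℂ → ℂ) (a : ℕ → ℂ) : Prop :=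
  DifferentiableOn ℂ φ rightHalfPlane ∧
    ∃ σ : ℝ, ∀ s : ℂ, σ < s.re → LSeriesHasSum a s (φ s)

/-- `φ` is a convergent Dirichlet series. -/
def IsConvergentDirichletSeries (φ : ℂ → ℂ) : Prop :=
  ∃ a : ℕ → ℂ, HasDirichletExpansion φ a

/-- The infinite-dimensional torus `𝕋^∞`, with one circle `ℝ/ℤ` for each prime number; the point
`x` stands for `z = (exp (2 π i xₚ))ₚ`. -/
abbrev InfTorus : Type := Nat.Primes → UnitAddCircle

/-- The normalised Haar measure of `𝕋^∞`. -/
def infTorusMeasure : Measure InfTorus :=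
  Measure.infinitePi fun _ : Nat.Primes => (AddCircle.haarAddCircle : Measure UnitAddCircle)

/-- The character `z ↦ ∏ₚ zₚ ^ αₚ` of `𝕋^∞`. -/
def torusChar (α : Nat.Primes →₀ ℤ) (x : InfTorus) : ℂ := α.prod fun p k => fourier k (x p)

/-- The Fourier coefficient `∫ F conj(z^α)` of `F` at `α`. -/
def torusFourierCoeff (F : InfTorus → ℂ) (α : Nat.Primes →₀ ℤ) : ℂ :=
  ∫ x, F x * torusChar (-α) x ∂infTorusMeasure

/-- `F` belongs to `H^q(𝕋^∞)` (`1 ≤ q < ∞`) and its Taylor series is the Bohr lift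
`∑_α a_n z^α`, `n = ∏ₚ p ^ αₚ`, of `∑ aₙ n⁻ˢ`: `F ∈ L^q`, its Fourier coefficient at each `α ≥ 0`
is `a_n`, and its other Fourier coefficients vanish. -/
def IsHardyBohrLift (q : ℝ) (a : ℕ → ℂ) (F : InfTorus → ℂ) : Prop :=
  MemLp F (ENNReal.ofReal q) infTorusMeasure ∧
  (∀ α : Nat.Primes →₀ ℕ,
    torusFourierCoeff F (α.mapRange (fun k : ℕ => (k : ℤ)) rfl)
      = a (α.prod fun p k => (p : ℕ) ^ k)) ∧
  ∀ α : Nat.Primes →₀ ℤ, (∃ p, α p < 0) → torusFourierCoeff F α = 0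

/-- `φ` belongs to the Hardy space `ℋ^q` of Dirichlet series (`1 ≤ q < ∞`). -/
def MemDirichletHardy (q : ℝ) (φ : ℂ → ℂ) : Prop :=
  ∃ a : ℕ → ℂ, HasDirichletExpansion φ a ∧ ∃ F : InfTorus → ℂ, IsHardyBohrLift q a F

end

/-!
The symbol is `φ(s) = 4 + (1 - 2⁻ˢ)⁻ᵃ` with `a = 1/p < 1`, a function of the single variable
`z = 2⁻ˢ`.

*Hardy spaces.* The Bohr lift is `4 + (1 - z₂)⁻ᵃ`, and `|1 - z|⁻ᵃ` is in `L^q` of the circle for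
`a q < 1`; its Fourier coefficients are found by dominated convergence along `r z₂`, `r → 1⁻`
(`isHardyBohrLift_cuspSymbol`). A lift `F` in `L^p` is impossible
(`not_isHardyBohrLift_of_growth`): the coefficients of `φ` are unique, so the Poisson integral of
any such `F` in the variable `z₂` at the point `r` equals `g(r) = 4 + (1 - r)⁻ᵃ`. Since
`(1 - r) P_r` is bounded and tends to `0` almost everywhere, `∫ |F|^p (1 - r) P_r → 0`, which forces
`(1 - r) |g(r)|^p → 0`, while in fact `(1 - r) |g(r)|^p ≥ 1`. No uniqueness theorem for Fourier
series on the infinite torus is needed.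

*The operator.* `C_φ` maps `n⁻ˢ` to `n⁻ᵠ = n⁻⁴ exp (-log n (1 - z)⁻ᵃ)`. As `a < 1`, the function
`(1 - z)⁻ᵃ` takes values in a sector strictly inside the right half-plane, so the exponential decays
at `z = 1` fast enough for its second derivative to be bounded on the disc by a constant times
`log² n + log n`. By Cauchy's estimates the Taylor coefficients are `O(1/k²)`, and the norm of `n⁻ᵠ`
in `𝒜⁺` is `O(n⁻²)` (`exists_wienerAlgebra_natCast_cpow_neg_cuspSymbol`). Hence
`C_φ = ∑ aₙ(·) n⁻ᵠ` is a nuclear operator on the Banach space `𝒜⁺`, and nuclear operators are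
compact and absolutely summing.
-/

open scoped Topology ComplexConjugate

noncomputable section

/-! ### Nuclear operators -/

section Nuclear

variable {X Y : Type*} [NormedAddCommGroup X] [NormedSpace ℂ X]
  [NormedAddCommGroup Y] [NormedSpace ℂ Y]

theorem isCompactOperator_smulRight (ξ : StrongDual ℂ X) (y : Y) :
    IsCompactOperator (ξ.smulRight y) := by
  have h : IsCompactOperator ξ := by
    refine ⟨Metric.closedBall 0 1, isCompact_closedBall _ _, ?_⟩
    exact ξ.continuous.continuousAt.preimage_mem_nhds
      (by simpa using Metric.closedBall_mem_nhds (0 : ℂ) one_pos)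
  exact h.clm_comp (ContinuousLinearMap.smulRight (1 : ℂ →L[ℂ] ℂ) y)

theorem norm_smulRight_le_of_norm_le_one {ξ : StrongDual ℂ X} (hξ : ‖ξ‖ ≤ 1) (y : Y) :
    ‖ξ.smulRight y‖ ≤ ‖y‖ := by
  rw [ContinuousLinearMap.norm_smulRight_apply]
  exact mul_le_of_le_one_left (norm_nonneg _) hξ

/-- The nuclear operator `x ↦ ∑ ξₙ(x) uₙ`. -/
def nuclearOperator (ξ : ℕ → StrongDual ℂ X) (u : ℕ → Y) : X →L[ℂ] Y :=
  ∑' n, (ξ n).smulRight (u n)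

variable [CompleteSpace Y] {ξ : ℕ → StrongDual ℂ X} {u : ℕ → Y}

theorem hasSum_nuclearOperator (hξ : ∀ n, ‖ξ n‖ ≤ 1) (hu : Summable fun n => ‖u n‖) :
    HasSum (fun n => (ξ n).smulRight (u n)) (nuclearOperator ξ u) :=
  (Summable.of_norm_bounded hu fun n => norm_smulRight_le_of_norm_le_one (hξ n) _).hasSum

theorem hasSum_nuclearOperator_apply (hξ : ∀ n, ‖ξ n‖ ≤ 1) (hu : Summable fun n => ‖u n‖) (x : X) :
    HasSum (fun n => ξ n x • u n) (nuclearOperator ξ u x) :=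
  (hasSum_nuclearOperator hξ hu).mapL (ContinuousLinearMap.apply ℂ Y x)

theorem isCompactOperator_nuclearOperator (hξ : ∀ n, ‖ξ n‖ ≤ 1)
    (hu : Summable fun n => ‖u n‖) : IsCompactOperator (nuclearOperator ξ u) := by
  refine isCompactOperator_of_tendsto (hasSum_nuclearOperator hξ hu)
    (Eventually.of_forall fun s => ?_)
  induction s using Finset.cons_induction with
  | empty => simpa using isCompactOperator_zero
  | cons n s hn ih =>
    rw [Finset.sum_cons]
    exact (isCompactOperator_smulRight _ _).add ih

/-- A nuclear operator is absolutely summing: the bound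
`∑ₖ ‖T xₖ‖ ≤ ∑ₙ ‖uₙ‖ ∑ₖ |ξₙ(xₖ)|` only involves functionals in the dual unit ball. -/
theorem isAbsolutelySumming_nuclearOperator (hξ : ∀ n, ‖ξ n‖ ≤ 1)
    (hu : Summable fun n => ‖u n‖) : IsAbsolutelySumming (nuclearOperator ξ u) := by
  refine ⟨∑' n, ‖u n‖ + 1, by positivity, fun N x => ?_⟩
  set S := ⨆ ζ : Metric.closedBall (0 : StrongDual ℂ X) 1, ∑ k, ‖ζ.1 (x k)‖
  have hbdd : BddAbove (range fun ζ : Metric.closedBall (0 : StrongDual ℂ X) 1 =>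
      ∑ k, ‖ζ.1 (x k)‖) := by
    refine ⟨∑ k, ‖x k‖, ?_⟩
    rintro _ ⟨ζ, rfl⟩
    refine Finset.sum_le_sum fun k _ => ?_
    have hζ : ‖ζ.1‖ ≤ 1 := mem_closedBall_zero_iff.mp ζ.2
    exact (ζ.1.le_opNorm _).trans (mul_le_of_le_one_left (norm_nonneg _) hζ)
  have hS : ∀ n, ∑ k, ‖ξ n (x k)‖ ≤ S := fun n =>
    le_ciSup hbdd ⟨ξ n, by simpa using hξ n⟩
  have hS0 : 0 ≤ S := (Finset.sum_nonneg fun _ _ => norm_nonneg _).trans (hS 0)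
  have hsum : ∀ k, Summable fun n => ‖ξ n (x k)‖ * ‖u n‖ := fun k =>
    Summable.of_nonneg_of_le (fun n => by positivity)
      (fun n => mul_le_mul_of_nonneg_right (((ξ n).le_opNorm _).trans
        (mul_le_of_le_one_left (norm_nonneg _) (hξ n))) (norm_nonneg _)) (hu.mul_left ‖x k‖)
  calc ∑ k, ‖nuclearOperator ξ u (x k)‖
      ≤ ∑ k, ∑' n, ‖ξ n (x k)‖ * ‖u n‖ := by
        refine Finset.sum_le_sum fun k _ => ?_
        rw [← (hasSum_nuclearOperator_apply hξ hu (x k)).tsum_eq]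
        have h := hsum k
        simp only [← norm_smul] at h ⊢
        exact norm_tsum_le_tsum_norm h
    _ = ∑' n, (∑ k, ‖ξ n (x k)‖) * ‖u n‖ := by
        rw [← Summable.tsum_finsetSum fun k _ => hsum k]
        simp only [Finset.sum_mul]
    _ ≤ ∑' n, S * ‖u n‖ := by
        refine Summable.tsum_le_tsum (fun n => mul_le_mul_of_nonneg_right (hS n) (norm_nonneg _))
          ?_ (hu.mul_left S)
        simp only [Finset.sum_mul]
        exact summable_sum fun k _ => hsum k
    _ = (∑' n, ‖u n‖) * S := by rw [tsum_mul_left, mul_comm]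
    _ ≤ (∑' n, ‖u n‖ + 1) * S := by gcongr; linarith

end Nuclear

/-! ### The Wiener algebra as a Banach space -/

namespace WienerAlgebra

/-- The element of `𝒜⁺` with prescribed absolutely summable coefficients. -/
def ofCoeff (a : ℕ → ℂ) (h0 : a 0 = 0) (ha : Summable fun n => ‖a n‖) : WienerAlgebra :=
  ⟨fun s => LSeries a s, a, h0, ha, fun s =>
    (lseriesSummable_of_summable_norm ha (le_of_lt s.2)).LSeriesHasSum⟩

theorem coeff_ofCoeff (a : ℕ → ℂ) (h0 : a 0 = 0) (ha : Summable fun n => ‖a n‖) :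
    (ofCoeff a h0 ha).coeff = a :=
  coeff_eq _ ⟨h0, ha, fun s =>
    (lseriesSummable_of_summable_norm ha (le_of_lt s.2)).LSeriesHasSum⟩

theorem norm_coeff_le (f : WienerAlgebra) (n : ℕ) : ‖f.coeff n‖ ≤ ‖f‖ :=
  f.isWienerExpansion_coeff.2.1.le_tsum n fun _ _ => norm_nonneg _

/-- The coefficient functional `f ↦ aₙ`. -/
def coeffCLM (n : ℕ) : StrongDual ℂ WienerAlgebra :=
  LinearMap.mkContinuous
    { toFun := fun f => f.coeff n
      map_add' := fun f g => by rw [coeff_add]; rfl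
      map_smul' := fun c f => by rw [coeff_smul]; rfl } 1
    fun f => by simpa using f.norm_coeff_le n

@[simp]
theorem coeffCLM_apply (n : ℕ) (f : WienerAlgebra) : coeffCLM n f = f.coeff n := rfl

theorem norm_coeffCLM_le (n : ℕ) : ‖coeffCLM n‖ ≤ 1 :=
  LinearMap.mkContinuous_norm_le _ zero_le_one _

theorem norm_term_le (f : WienerAlgebra) (s : rightHalfPlane) (n : ℕ) :
    ‖LSeries.term f.coeff s n‖ ≤ ‖f.coeff n‖ := by
  rcases eq_or_ne n 0 with rfl | hn
  · simp
  · rw [LSeries.norm_term_eq, if_neg hn]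
    exact div_le_self (norm_nonneg _)
      (Real.one_le_rpow (mod_cast Nat.one_le_iff_ne_zero.mpr hn) (le_of_lt s.2))

theorem norm_apply_le (f : WienerAlgebra) (s : rightHalfPlane) : ‖f s‖ ≤ ‖f‖ :=
  (f.isWienerExpansion_coeff.2.2 s).norm_le_of_bounded
    f.isWienerExpansion_coeff.2.1.hasSum (f.norm_term_le s)

/-- Evaluation at a point of `ℂ₀`. -/
def evalCLM (s : rightHalfPlane) : StrongDual ℂ WienerAlgebra :=
  LinearMap.mkContinuous
    { toFun := fun f => f s
      map_add' := fun _ _ => rfl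
      map_smul' := fun _ _ => rfl } 1
    fun f => (f.norm_apply_le s).trans_eq (one_mul _).symm

@[simp]
theorem evalCLM_apply (s : rightHalfPlane) (f : WienerAlgebra) : evalCLM s f = f s := rfl

theorem memℓp_coeff (f : WienerAlgebra) : Memℓp f.coeff 1 :=
  memℓp_gen (by simpa using f.isWienerExpansion_coeff.2.1)

/-- `𝒜⁺` embeds isometrically into `ℓ¹` through its coefficients. -/
def coeffIsometry : WienerAlgebra →ₗᵢ[ℂ] lp (fun _ : ℕ => ℂ) 1 where
  toFun f := ⟨f.coeff, f.memℓp_coeff⟩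
  map_add' f g := Subtype.ext (coeff_add f g)
  map_smul' c f := Subtype.ext (coeff_smul c f)
  norm_map' f := by
    rw [norm_def, lp.norm_eq_tsum_rpow (by simp)]
    simp

theorem range_coeffIsometry :
    range coeffIsometry = {a : lp (fun _ : ℕ => ℂ) 1 | a 0 = 0} := by
  ext a
  constructor
  · rintro ⟨f, rfl⟩
    exact f.isWienerExpansion_coeff.1
  · intro h0
    have ha : Summable fun n => ‖a n‖ := by simpa using (lp.memℓp a).summable (by simp)
    exact ⟨ofCoeff a h0 ha, Subtype.ext (coeff_ofCoeff _ h0 ha)⟩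

instance : CompleteSpace WienerAlgebra := by
  rw [completeSpace_iff_isComplete_range coeffIsometry.isometry.isUniformInducing,
    range_coeffIsometry]
  refine IsClosed.isComplete (isClosed_eq ?_ continuous_const)
  exact (lp.evalCLM ℂ (fun _ : ℕ => ℂ) 1 0).continuous

/-- If the functions `n⁻ᵠ` lie in `𝒜⁺` and their norms are summable, then composition with `φ`
is the nuclear operator `∑ aₙ n⁻ˢ ↦ ∑ aₙ n⁻ᵠ`. -/
theorem isCompositionOperator_nuclearOperator {φ : ℂ → ℂ}
    (hφ : MapsTo φ rightHalfPlane rightHalfPlane) {u : ℕ → WienerAlgebra}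
    (hu : Summable fun n => ‖u n‖)
    (hφu : ∀ n ≠ 0, ∀ s : rightHalfPlane, u n s = (n : ℂ) ^ (-φ s)) :
    IsCompositionOperator φ (nuclearOperator coeffCLM u) := by
  refine ⟨hφ, fun f s => ?_⟩
  have h := (hasSum_nuclearOperator_apply norm_coeffCLM_le hu f).mapL (evalCLM s)
  refine h.unique ?_
  have key := f.isWienerExpansion_coeff.2.2 ⟨φ s, hφ s.2⟩
  rw [LSeriesHasSum] at key
  convert! key using 1
  funext n
  rcases eq_or_ne n 0 with rfl | hn
  · rw [map_smul, coeffCLM_apply, f.isWienerExpansion_coeff.1, zero_smul, LSeries.term_zero]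
  · simp [LSeries.term_of_ne_zero hn, hφu n hn s, Complex.cpow_neg, div_eq_mul_inv]

end WienerAlgebra

/-! ### Dirichlet series over the powers of two -/

/-- The coefficients of the Dirichlet series `∑ cₖ (2ᵏ)⁻ˢ` that arises from the power series
`∑ cₖ zᵏ` by the substitution `z = 2⁻ˢ`. -/
def twoPowCoeff (c : ℕ → ℂ) : ℕ → ℂ := Function.extend (fun k => 2 ^ k) c 0

theorem two_pow_injective : Function.Injective fun k : ℕ => 2 ^ k :=
  Nat.pow_right_injective le_rfl

@[simp]
theorem twoPowCoeff_two_pow (c : ℕ → ℂ) (k : ℕ) : twoPowCoeff c (2 ^ k) = c k :=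
  two_pow_injective.extend_apply c 0 k

theorem twoPowCoeff_of_notMem (c : ℕ → ℂ) {n : ℕ} (hn : n ∉ range fun k : ℕ => 2 ^ k) :
    twoPowCoeff c n = 0 :=
  Function.extend_apply' _ _ _ fun ⟨k, hk⟩ => hn ⟨k, hk⟩

theorem twoPowCoeff_zero (c : ℕ → ℂ) : twoPowCoeff c 0 = 0 :=
  twoPowCoeff_of_notMem c fun ⟨k, hk⟩ => by simp at hk

theorem hasSum_norm_twoPowCoeff_iff {c : ℕ → ℂ} {r : ℝ} :
    HasSum (fun n => ‖twoPowCoeff c n‖) r ↔ HasSum (fun k => ‖c k‖) r := by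
  rw [← two_pow_injective.hasSum_iff (f := fun n => ‖twoPowCoeff c n‖)
    fun n hn => by rw [twoPowCoeff_of_notMem c hn, norm_zero]]
  simp [Function.comp_def]

theorem lseriesHasSum_twoPowCoeff_iff {c : ℕ → ℂ} {s v : ℂ} :
    LSeriesHasSum (twoPowCoeff c) s v ↔ HasSum (fun k => c k * ((2 : ℂ) ^ (-s)) ^ k) v := by
  rw [LSeriesHasSum, ← two_pow_injective.hasSum_iff
    fun n hn => by simp [LSeries.term_def, twoPowCoeff_of_notMem c hn]]
  refine iff_of_eq (congrArg (fun f => HasSum f v) (funext fun k => ?_))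
  have h : ((2 : ℂ) ^ k) ^ s = ((2 : ℂ) ^ s) ^ k := by
    rw [← Complex.cpow_nat_mul]
    exact_mod_cast (Complex.natCast_cpow_natCast_mul 2 k s).symm
  simp [LSeries.term_of_ne_zero, h, Complex.cpow_neg, div_eq_mul_inv]

theorem two_cpow_neg_mem_ball {s : ℂ} (hs : 0 < s.re) :
    (2 : ℂ) ^ (-s) ∈ Metric.ball (0 : ℂ) 1 := by
  have h : ‖(2 : ℂ) ^ (-s)‖ = (2 : ℝ) ^ (-s.re) := by
    simpa using Complex.norm_cpow_eq_rpow_re_of_pos (x := 2) two_pos (-s)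
  rw [mem_ball_zero_iff, h]
  exact Real.rpow_lt_one_of_one_lt_of_neg one_lt_two (neg_lt_zero.mpr hs)

/-- If `g` is the sum of an absolutely convergent power series, then `s ↦ g (2⁻ˢ)` belongs to
`𝒜⁺`, with norm the sum of the absolute values of the Taylor coefficients of `g`. -/
theorem WienerAlgebra.exists_of_hasSum {c : ℕ → ℂ} (hc : Summable fun k => ‖c k‖) {g : ℂ → ℂ}
    (hg : ∀ z ∈ Metric.ball (0 : ℂ) 1, HasSum (fun k => c k * z ^ k) (g z)) :
    ∃ u : WienerAlgebra, ‖u‖ = ∑' k, ‖c k‖ ∧ ∀ s : rightHalfPlane, u s = g (2 ^ (-(s : ℂ))) := by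
  have h := hasSum_norm_twoPowCoeff_iff.mpr hc.hasSum
  refine ⟨WienerAlgebra.ofCoeff (twoPowCoeff c) (twoPowCoeff_zero c) h.summable, ?_, fun s => ?_⟩
  · rw [WienerAlgebra.norm_def, WienerAlgebra.coeff_ofCoeff, h.tsum_eq]
  · exact (lseriesHasSum_twoPowCoeff_iff.mpr (hg _ (two_cpow_neg_mem_ball s.2))).LSeries_eq

theorem HasDirichletExpansion.of_hasSum {c : ℕ → ℂ} {g : ℂ → ℂ}
    (hd : DifferentiableOn ℂ g (Metric.ball 0 1))
    (hg : ∀ z ∈ Metric.ball (0 : ℂ) 1, HasSum (fun k => c k * z ^ k) (g z)) :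
    HasDirichletExpansion (fun s => g (2 ^ (-s))) (twoPowCoeff c) := by
  refine ⟨hd.comp (fun s _ => ?_) fun s hs => two_cpow_neg_mem_ball hs, 0, fun s hs =>
    lseriesHasSum_twoPowCoeff_iff.mpr (hg _ (two_cpow_neg_mem_ball hs))⟩
  exact (differentiableAt_id.neg.const_cpow (Or.inl two_ne_zero)).differentiableWithinAt

/-- A convergent Dirichlet series determines its coefficients. -/
theorem HasDirichletExpansion.unique {φ : ℂ → ℂ} {a b : ℕ → ℂ} (ha : HasDirichletExpansion φ a)
    (hb : HasDirichletExpansion φ b) {n : ℕ} (hn : n ≠ 0) : a n = b n := by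
  obtain ⟨-, σ, ha⟩ := ha
  obtain ⟨-, τ, hb⟩ := hb
  have key : ∀ {c : ℕ → ℂ} {θ : ℝ}, (∀ s : ℂ, θ < s.re → LSeriesHasSum c s (φ s)) →
      LSeries.abscissaOfAbsConv c < ⊤ := fun {c θ} hc =>
    (LSeriesSummable.abscissaOfAbsConv_le (s := ((θ + 1 : ℝ) : ℂ))
      (hc _ (by simp)).LSeriesSummable).trans_lt (EReal.coe_lt_top _)
  refine LSeries.eq_of_LSeries_eventually_eq (key ha) (key hb) ?_ hn
  filter_upwards [eventually_gt_atTop σ, eventually_gt_atTop τ] with x hx hx'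
  exact (ha x (by simpa using hx)).LSeries_eq.trans (hb x (by simpa using hx')).LSeries_eq.symm

/-! ### Absolute convergence of Taylor series -/

/-- The `k`-th Taylor coefficient of `f` at the origin. -/
def taylorCoeff (f : ℂ → ℂ) (k : ℕ) : ℂ := (k.factorial : ℂ)⁻¹ * iteratedDeriv k f 0

theorem hasSum_taylorCoeff {f : ℂ → ℂ} (hf : DifferentiableOn ℂ f (Metric.ball 0 1)) {z : ℂ}
    (hz : z ∈ Metric.ball (0 : ℂ) 1) : HasSum (fun k => taylorCoeff f k * z ^ k) (f z) := by
  convert! Complex.hasSum_taylorSeries_on_ball hf hz using 2 with k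
  simp only [taylorCoeff, sub_zero, smul_eq_mul]
  ring

theorem norm_iteratedDeriv_le_of_bounded_ball {f : ℂ → ℂ}
    (hf : DifferentiableOn ℂ f (Metric.ball 0 1)) {M : ℝ}
    (hM : ∀ z ∈ Metric.ball (0 : ℂ) 1, ‖f z‖ ≤ M) (k : ℕ) :
    ‖iteratedDeriv k f 0‖ ≤ k.factorial * M := by
  have h : ∀ r ∈ Ioo (0 : ℝ) 1, ‖iteratedDeriv k f 0‖ ≤ k.factorial * M / r ^ k := fun r hr =>
    Complex.norm_iteratedDeriv_le_of_forall_mem_sphere_norm_le k hr.1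
      ((hf.mono (Metric.closedBall_subset_ball hr.2)).diffContOnCl_ball subset_rfl)
      fun z hz => hM z (Metric.sphere_subset_closedBall.trans
        (Metric.closedBall_subset_ball hr.2) hz)
  have hlim : Tendsto (fun r : ℝ => k.factorial * M / r ^ k) (𝓝[<] 1)
      (𝓝 (k.factorial * M / 1 ^ k)) :=
    (tendsto_const_nhds.div (tendsto_id.pow k) (by simp)).mono_left nhdsWithin_le_nhds
  rw [one_pow, div_one] at hlim
  exact ge_of_tendsto hlim (eventually_of_mem (Ioo_mem_nhdsLT one_pos) h)

theorem summable_inv_nat_add_one_sq : Summable fun k : ℕ => (((k : ℝ) + 1) ^ 2)⁻¹ := by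
  have h := (summable_nat_add_iff 1).mpr (Real.summable_nat_pow_inv.mpr one_lt_two)
  simpa using h

/-- A bounded second derivative makes the Taylor coefficients `O(1/k²)`, by Cauchy's estimates. -/
theorem norm_taylorCoeff_add_two_le {f : ℂ → ℂ} (hf : DifferentiableOn ℂ f (Metric.ball 0 1))
    {M : ℝ} (hM : ∀ z ∈ Metric.ball (0 : ℂ) 1, ‖deriv (deriv f) z‖ ≤ M) (k : ℕ) :
    ‖taylorCoeff f (k + 2)‖ ≤ M * (((k : ℝ) + 1) ^ 2)⁻¹ := by
  have hM0 : 0 ≤ M := (norm_nonneg _).trans (hM 0 (by simp))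
  have h := norm_iteratedDeriv_le_of_bounded_ball
    ((hf.deriv Metric.isOpen_ball).deriv Metric.isOpen_ball) hM k
  rw [taylorCoeff, iteratedDeriv_succ', iteratedDeriv_succ', norm_mul, norm_inv,
    Complex.norm_natCast]
  have hk : (0 : ℝ) < k.factorial := by positivity
  calc ((k + 2).factorial : ℝ)⁻¹ * ‖iteratedDeriv k (deriv (deriv f)) 0‖
      ≤ ((k + 2).factorial : ℝ)⁻¹ * (k.factorial * M) := by gcongr
    _ = M * (((k : ℝ) + 2) * (k + 1))⁻¹ := by
      rw [Nat.factorial_succ, Nat.factorial_succ]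
      push_cast
      field_simp
      ring
    _ ≤ M * (((k : ℝ) + 1) ^ 2)⁻¹ := by
      gcongr
      nlinarith

theorem summable_norm_taylorCoeff {f : ℂ → ℂ} (hf : DifferentiableOn ℂ f (Metric.ball 0 1))
    {M : ℝ} (hM : ∀ z ∈ Metric.ball (0 : ℂ) 1, ‖deriv (deriv f) z‖ ≤ M) :
    Summable fun k => ‖taylorCoeff f k‖ :=
  (summable_nat_add_iff 2).mp (Summable.of_nonneg_of_le (fun _ => norm_nonneg _)
    (norm_taylorCoeff_add_two_le hf hM) (summable_inv_nat_add_one_sq.mul_left M))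

theorem tsum_norm_taylorCoeff_le {f : ℂ → ℂ} (hf : DifferentiableOn ℂ f (Metric.ball 0 1))
    {M : ℝ} (hM : ∀ z ∈ Metric.ball (0 : ℂ) 1, ‖deriv (deriv f) z‖ ≤ M) :
    ∑' k, ‖taylorCoeff f k‖ ≤ ‖f 0‖ + ‖deriv f 0‖ + M * ∑' k : ℕ, (((k : ℝ) + 1) ^ 2)⁻¹ := by
  have hs := summable_norm_taylorCoeff hf hM
  rw [← hs.sum_add_tsum_nat_add 2]
  refine add_le_add (by simp [Finset.sum_range_succ, taylorCoeff]) ?_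
  rw [← tsum_mul_left]
  exact Summable.tsum_le_tsum (norm_taylorCoeff_add_two_le hf hM)
    ((summable_nat_add_iff 2).mpr hs) (summable_inv_nat_add_one_sq.mul_left M)

/-! ### The function `(1 - z)⁻ᵃ` on the unit disc -/

/-- The function `z ↦ (1 - z)⁻ᵃ`. -/
def cuspFun (a : ℝ) (z : ℂ) : ℂ := (1 - z) ^ (-a : ℂ)

theorem one_sub_re_pos {z : ℂ} (hz : z ∈ Metric.ball (0 : ℂ) 1) : 0 < (1 - z).re := by
  have := (Complex.re_le_norm z).trans_lt (mem_ball_zero_iff.mp hz)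
  simpa using this

theorem one_sub_norm_pos {z : ℂ} (hz : z ∈ Metric.ball (0 : ℂ) 1) : 0 < ‖1 - z‖ :=
  (one_sub_re_pos hz).trans_le (Complex.re_le_norm _)

theorem norm_cuspFun (a : ℝ) (z : ℂ) : ‖cuspFun a z‖ = ‖1 - z‖ ^ (-a) := by
  rw [cuspFun, ← Complex.ofReal_neg, Complex.norm_cpow_real]

theorem cuspFun_zero (a : ℝ) : cuspFun a 0 = 1 := by simp [cuspFun]

theorem hasDerivAt_cuspFun (a : ℝ) {z : ℂ} (hz : z ∈ Metric.ball (0 : ℂ) 1) :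
    HasDerivAt (cuspFun a) (a * cuspFun (a + 1) z) z := by
  have h := ((hasDerivAt_id z).const_sub 1).cpow_const (c := (-a : ℂ))
    (Or.inl (one_sub_re_pos hz))
  convert! h using 1
  have : (-a : ℂ) - 1 = -(a + 1 : ℝ) := by push_cast; ring
  simp only [cuspFun, id, this]
  ring

theorem differentiableOn_cuspFun (a : ℝ) : DifferentiableOn ℂ (cuspFun a) (Metric.ball 0 1) :=
  fun _ hz => (hasDerivAt_cuspFun a hz).differentiableAt.differentiableWithinAt

/-- For `a < 1` the values of `(1 - z)⁻ᵃ` lie in a sector smaller than the half-plane. -/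
theorem le_re_cuspFun {a : ℝ} (ha0 : 0 ≤ a) (ha1 : a < 1) {z : ℂ}
    (hz : z ∈ Metric.ball (0 : ℂ) 1) :
    Real.cos (a * (Real.pi / 2)) * ‖1 - z‖ ^ (-a) ≤ (cuspFun a z).re := by
  have harg : |(1 - z).arg| ≤ Real.pi / 2 :=
    Complex.abs_arg_le_pi_div_two_iff.mpr (one_sub_re_pos hz).le
  rw [cuspFun, ← Complex.ofReal_neg, Complex.cpow_ofReal_re, mul_comm]
  gcongr
  rw [← Real.cos_abs ((1 - z).arg * -a), abs_mul, abs_neg, abs_of_nonneg ha0, mul_comm _ a]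
  have hpi := Real.pi_pos
  refine Real.cos_le_cos_of_nonneg_of_le_pi (by positivity) ?_ (by gcongr)
  nlinarith

theorem cos_mul_pi_div_two_pos {a : ℝ} (ha0 : 0 ≤ a) (ha1 : a < 1) :
    0 < Real.cos (a * (Real.pi / 2)) := by
  have hpi := Real.pi_pos
  refine Real.cos_pos_of_mem_Ioo ⟨?_, ?_⟩ <;> nlinarith

theorem exists_rpow_mul_exp_neg_le {a δ : ℝ} (ha : 0 < a) (hδ : 0 < δ) {b : ℝ} (hb : 0 ≤ b) :
    ∃ C, ∀ t : ℝ, 0 ≤ t → t ^ b * Real.exp (-δ * t ^ a) ≤ C := by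
  set g : ℝ → ℝ := fun y => y ^ (b / a) * Real.exp (-δ * y)
  have hg : Tendsto g atTop (𝓝 0) := tendsto_rpow_mul_exp_neg_mul_atTop_nhds_zero _ _ hδ
  obtain ⟨R, hR⟩ := (hg.eventually (eventually_le_nhds one_pos)).exists_forall_of_atTop
  refine ⟨max 1 (R ^ (b / a)), fun t ht => ?_⟩
  have hgt : t ^ b * Real.exp (-δ * t ^ a) = g (t ^ a) := by
    simp only [g]
    rw [← Real.rpow_mul ht, mul_div_cancel₀ _ ha.ne']
  have hta : 0 ≤ t ^ a := by positivity
  rw [hgt]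
  rcases le_total R (t ^ a) with h | h
  · exact (hR _ h).trans (le_max_left _ _)
  · refine le_trans ?_ (le_max_right _ _)
    calc g (t ^ a) ≤ (t ^ a) ^ (b / a) * 1 := by
          refine mul_le_mul_of_nonneg_left (Real.exp_le_one_iff.mpr ?_) (by positivity)
          nlinarith
      _ ≤ R ^ (b / a) := by rw [mul_one]; gcongr

theorem hasDerivAt_exp_cuspFun (a l : ℝ) {z : ℂ} (hz : z ∈ Metric.ball (0 : ℂ) 1) :
    HasDerivAt (fun z => Complex.exp (-l * cuspFun a z))
      (Complex.exp (-l * cuspFun a z) * (-l * (a * cuspFun (a + 1) z))) z :=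
  ((hasDerivAt_cuspFun a hz).const_mul (-l : ℂ)).cexp

theorem deriv_deriv_exp_cuspFun (a l : ℝ) {z : ℂ} (hz : z ∈ Metric.ball (0 : ℂ) 1) :
    deriv (deriv fun z => Complex.exp (-l * cuspFun a z)) z =
      Complex.exp (-l * cuspFun a z) * (l * a * cuspFun (a + 1) z) ^ 2 -
      Complex.exp (-l * cuspFun a z) * (l * a * (a + 1) * cuspFun (a + 2) z) := by
  have h1 : (deriv fun z => Complex.exp (-l * cuspFun a z)) =ᶠ[𝓝 z]
      fun z => Complex.exp (-l * cuspFun a z) * (-l * (a * cuspFun (a + 1) z)) := by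
    filter_upwards [Metric.isOpen_ball.mem_nhds hz] with w hw
    exact (hasDerivAt_exp_cuspFun a l hw).deriv
  have h2 := (hasDerivAt_exp_cuspFun a l hz).mul
    (((hasDerivAt_cuspFun (a + 1) hz).const_mul (a : ℂ)).const_mul (-l : ℂ))
  rw [h1.deriv_eq]
  refine h2.deriv.trans ?_
  rw [show a + 1 + 1 = a + 2 by ring]
  push_cast
  ring

/-- The exponential decay of `exp (-λ (1 - z)⁻ᵃ)` at `z = 1` beats the poles produced by two
derivatives, uniformly in `λ ≥ λ₀`. -/
theorem exists_norm_deriv_deriv_exp_cuspFun_le {a l₀ : ℝ} (ha0 : 0 < a) (ha1 : a < 1)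
    (hl₀ : 0 < l₀) :
    ∃ C : ℝ, ∀ l : ℝ, l₀ ≤ l → ∀ z ∈ Metric.ball (0 : ℂ) 1,
      ‖deriv (deriv fun z => Complex.exp (-l * cuspFun a z)) z‖ ≤ C * (l ^ 2 + l) := by
  set δ := Real.cos (a * (Real.pi / 2))
  have hδ : 0 < δ := cos_mul_pi_div_two_pos ha0.le ha1
  obtain ⟨C₁, hC₁⟩ := exists_rpow_mul_exp_neg_le ha0 (mul_pos hl₀ hδ)
    (b := 2 * (a + 1)) (by positivity)
  obtain ⟨C₂, hC₂⟩ := exists_rpow_mul_exp_neg_le ha0 (mul_pos hl₀ hδ)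
    (b := a + 2) (by positivity)
  refine ⟨max (a ^ 2 * C₁) (a * (a + 1) * C₂), fun l hl z hz => ?_⟩
  have hl0 : 0 < l := hl₀.trans_le hl
  set t := ‖1 - z‖⁻¹
  have ht : 0 < t := inv_pos.mpr (one_sub_norm_pos hz)
  have hpow : ∀ b : ℝ, ‖cuspFun b z‖ = t ^ b := fun b => by
    rw [norm_cuspFun, Real.inv_rpow (norm_nonneg _), Real.rpow_neg (norm_nonneg _)]
  have hexp : ‖Complex.exp (-l * cuspFun a z)‖ ≤ Real.exp (-(l₀ * δ) * t ^ a) := by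
    rw [Complex.norm_exp, Real.exp_le_exp]
    have h := le_re_cuspFun ha0.le ha1 hz
    rw [← norm_cuspFun, hpow] at h
    have h2 : l₀ * (δ * t ^ a) ≤ l * (cuspFun a z).re := by gcongr
    simp only [neg_mul, Complex.neg_re, Complex.re_ofReal_mul]
    linarith
  rw [deriv_deriv_exp_cuspFun a l hz]
  have e1 : ‖Complex.exp (-l * cuspFun a z) * (l * a * cuspFun (a + 1) z) ^ 2‖ ≤
      (a ^ 2 * C₁) * l ^ 2 := by
    have h := hC₁ t ht.le
    rw [mul_comm 2, Real.rpow_mul ht.le, Real.rpow_two] at h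
    simp only [norm_mul, norm_pow, Complex.norm_real, Real.norm_eq_abs, abs_of_pos ha0,
      abs_of_pos hl0, hpow]
    calc _ ≤ Real.exp (-(l₀ * δ) * t ^ a) * (l * a * t ^ (a + 1)) ^ 2 := by gcongr
      _ = ((t ^ (a + 1)) ^ 2 * Real.exp (-(l₀ * δ) * t ^ a)) * (a ^ 2 * l ^ 2) := by ring
      _ ≤ C₁ * (a ^ 2 * l ^ 2) := by gcongr
      _ = _ := by ring
  have e2 : ‖Complex.exp (-l * cuspFun a z) * (l * a * (a + 1) * cuspFun (a + 2) z)‖ ≤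
      (a * (a + 1) * C₂) * l := by
    have h := hC₂ t ht.le
    have h1 : ‖(a + 1 : ℂ)‖ = a + 1 := by
      rw [← Complex.ofReal_one, ← Complex.ofReal_add, Complex.norm_real, Real.norm_of_nonneg]
      positivity
    simp only [norm_mul, h1, Complex.norm_real, Real.norm_eq_abs, abs_of_pos ha0,
      abs_of_pos hl0, hpow]
    calc _ ≤ Real.exp (-(l₀ * δ) * t ^ a) * (l * a * (a + 1) * t ^ (a + 2)) := by gcongr
      _ = (t ^ (a + 2) * Real.exp (-(l₀ * δ) * t ^ a)) * (l * a * (a + 1)) := by ring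
      _ ≤ C₂ * (l * a * (a + 1)) := by gcongr
      _ = _ := by ring
  calc _ ≤ _ := norm_sub_le _ _
    _ ≤ (a ^ 2 * C₁) * l ^ 2 + (a * (a + 1) * C₂) * l := add_le_add e1 e2
    _ ≤ max (a ^ 2 * C₁) (a * (a + 1) * C₂) * l ^ 2 +
        max (a ^ 2 * C₁) (a * (a + 1) * C₂) * l := by
      gcongr
      exacts [le_max_left _ _, le_max_right _ _]
    _ = _ := by ring

theorem differentiableOn_exp_cuspFun (a l : ℝ) :
    DifferentiableOn ℂ (fun z => Complex.exp (-l * cuspFun a z)) (Metric.ball 0 1) :=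
  fun _ hz => (hasDerivAt_exp_cuspFun a l hz).differentiableAt.differentiableWithinAt

/-- The Taylor series of `n ^ (-(1 - z)⁻ᵃ)` converges absolutely, with sum of order `n²`. -/
theorem exists_tsum_norm_taylorCoeff_exp_cuspFun_le {a : ℝ} (ha0 : 0 < a) (ha1 : a < 1) :
    ∃ C : ℝ, ∀ n : ℕ, n ≠ 0 →
      Summable (fun k => ‖taylorCoeff (fun z => Complex.exp (-Real.log n * cuspFun a z)) k‖) ∧
      ∑' k, ‖taylorCoeff (fun z => Complex.exp (-Real.log n * cuspFun a z)) k‖ ≤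
        C * (n : ℝ) ^ 2 := by
  obtain ⟨C, hC⟩ := exists_norm_deriv_deriv_exp_cuspFun_le ha0 ha1 (Real.log_pos one_lt_two)
  have hC0 : 0 ≤ C := by
    have h := (norm_nonneg _).trans (hC 1 (by linarith [Real.log_two_lt_d9]) 0 (by simp))
    norm_num at h
    linarith
  set S := ∑' k : ℕ, (((k : ℝ) + 1) ^ 2)⁻¹
  have hS0 : 0 ≤ S := tsum_nonneg fun _ => by positivity
  refine ⟨1 + a + C * 2 * S, fun n hn => ?_⟩
  set l := Real.log n
  have hn1 : (1 : ℝ) ≤ n := mod_cast Nat.one_le_iff_ne_zero.mpr hn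
  have hl0 : 0 ≤ l := Real.log_nonneg hn1
  have hln : l ≤ n := Real.log_le_self (by positivity)
  have hnn : (n : ℝ) ≤ n ^ 2 := by nlinarith
  have hM : ∀ z ∈ Metric.ball (0 : ℂ) 1,
      ‖deriv (deriv fun z => Complex.exp (-l * cuspFun a z)) z‖ ≤ C * (l ^ 2 + l) := by
    intro z hz
    rcases Nat.lt_or_ge 1 n with h1 | h1
    · exact hC l (Real.log_le_log two_pos (mod_cast h1)) z hz
    · -- for `n = 1` the function is constant
      have h : l = 0 := by
        have : n = 1 := by omega
        simp [l, this]
      rw [deriv_deriv_exp_cuspFun a l hz]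
      simp [h]
  have hf := differentiableOn_exp_cuspFun a l
  refine ⟨summable_norm_taylorCoeff hf hM, (tsum_norm_taylorCoeff_le hf hM).trans ?_⟩
  have h0 : ‖Complex.exp (-l * cuspFun a 0)‖ ≤ 1 := by
    rw [Complex.norm_exp, cuspFun_zero]
    simpa using hl0
  have h1 : ‖deriv (fun z => Complex.exp (-l * cuspFun a z)) 0‖ ≤ l * a := by
    rw [(hasDerivAt_exp_cuspFun a l (by simp)).deriv, norm_mul, cuspFun_zero (a + 1)]
    refine (mul_le_of_le_one_left (norm_nonneg _) h0).trans_eq ?_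
    simp [abs_of_nonneg hl0, abs_of_pos ha0]
  calc _ ≤ 1 + l * a + C * (l ^ 2 + l) * S := by gcongr
    _ ≤ (n : ℝ) ^ 2 + n ^ 2 * a + C * (n ^ 2 + n ^ 2) * S := by
      gcongr
      · nlinarith
      · exact hln.trans hnn
      · exact hln.trans hnn
    _ = _ := by ring

/-! ### Characters of the infinite torus -/

instance : IsProbabilityMeasure infTorusMeasure := by
  unfold infTorusMeasure; infer_instance

theorem norm_fourier_apply (n : ℤ) (y : UnitAddCircle) : ‖fourier n y‖ = 1 := by
  rw [fourier_apply]
  exact Circle.norm_coe _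

theorem norm_torusChar (α : Nat.Primes →₀ ℤ) (x : InfTorus) : ‖torusChar α x‖ = 1 := by
  rw [torusChar, Finsupp.prod, norm_prod]
  exact Finset.prod_eq_one fun p _ => norm_fourier_apply _ _

theorem torusChar_add (α β : Nat.Primes →₀ ℤ) (x : InfTorus) :
    torusChar (α + β) x = torusChar α x * torusChar β x :=
  Finsupp.prod_add_index' (by simp) fun _ _ _ => fourier_add

theorem measurable_torusChar (α : Nat.Primes →₀ ℤ) : Measurable (torusChar α) := by
  unfold torusChar Finsupp.prod
  refine Finset.measurable_prod _ fun p _ => ?_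
  exact (fourier _).continuous.measurable.comp (measurable_pi_apply p)

theorem integrable_torusChar (α : Nat.Primes →₀ ℤ) : Integrable (torusChar α) infTorusMeasure :=
  Integrable.of_bound (measurable_torusChar α).aestronglyMeasurable 1
    (ae_of_all _ fun x => (norm_torusChar α x).le)

theorem integral_fourier (n : ℤ) :
    ∫ t : UnitAddCircle, fourier n t ∂AddCircle.haarAddCircle = if n = 0 then 1 else 0 := by
  have h := congrFun (fourierCoeff_fourier (T := 1) n) 0
  simpa [fourierCoeff, Pi.single_apply, eq_comm] using h

theorem integral_torusChar (α : Nat.Primes →₀ ℤ) :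
    ∫ x, torusChar α x ∂infTorusMeasure = if α = 0 then 1 else 0 := by
  have h : ∫ x, torusChar α x ∂infTorusMeasure = ∏ p : α.support,
      ∫ t : UnitAddCircle, fourier (α p) t ∂AddCircle.haarAddCircle := by
    rw [← integral_fintype_prod_eq_prod]
    have hmeas : Measurable fun y : α.support → UnitAddCircle =>
        ∏ p : α.support, (fourier (α p) (y p) : ℂ) :=
      Finset.measurable_prod _ fun p _ =>
        (fourier _).continuous.measurable.comp (measurable_pi_apply p)
    refine Eq.trans ?_ (integral_restrict_infinitePi
      (μ := fun _ : Nat.Primes => (AddCircle.haarAddCircle : Measure UnitAddCircle))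
      hmeas.aestronglyMeasurable)
    refine integral_congr_ae (ae_of_all _ fun x => ?_)
    simp only [torusChar, Finsupp.prod, Finset.restrict]
    exact (Finset.prod_coe_sort α.support fun p => fourier (α p) (x p)).symm
  rw [h]
  split_ifs with hα
  · subst hα
    simp
  · obtain ⟨p, hp⟩ := Finsupp.support_nonempty_iff.mpr hα
    exact Finset.prod_eq_zero (Finset.mem_univ ⟨p, hp⟩)
      (by rw [integral_fourier, if_neg (Finsupp.mem_support_iff.mp hp)])

theorem torusFourierCoeff_torusChar (α β : Nat.Primes →₀ ℤ) :
    torusFourierCoeff (torusChar β) α = if β = α then 1 else 0 := by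
  simp only [torusFourierCoeff, ← torusChar_add, integral_torusChar, ← sub_eq_add_neg, sub_eq_zero]

/-- Integration against an absolutely convergent series of characters is done term by term. -/
theorem hasSum_integral_mul_torusChar {F G : InfTorus → ℂ} (hF : Integrable F infTorusMeasure)
    {c : ℕ → ℂ} (hc : Summable fun k => ‖c k‖) {e : ℕ → Nat.Primes →₀ ℤ}
    (hG : ∀ x, HasSum (fun k => c k * torusChar (e k) x) (G x)) :
    HasSum (fun k => c k * ∫ x, F x * torusChar (e k) x ∂infTorusMeasure)
      (∫ x, F x * G x ∂infTorusMeasure) := by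
  have hint : ∀ k, Integrable (fun x => F x * torusChar (e k) x) infTorusMeasure := fun k =>
    hF.mul_bdd (measurable_torusChar _).aestronglyMeasurable
      (ae_of_all _ fun x => (norm_torusChar (e k) x).le)
  have h := hasSum_integral_of_summable_integral_norm
    (F := fun k x => c k * (F x * torusChar (e k) x)) (μ := infTorusMeasure)
    (fun k => (hint k).const_mul _) ?_
  · simp only [integral_const_mul] at h
    convert! h using 1
    refine integral_congr_ae (ae_of_all _ fun x => ?_)
    refine (((hG x).mul_left (F x)).congr_fun ?_).tsum_eq.symm
    intro k
    ring
  · simp only [norm_mul, norm_torusChar, mul_one, integral_const_mul]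
    exact hc.mul_right _

/-! ### The coordinate of the prime two -/

/-- The prime two. -/
def primeTwo : Nat.Primes := ⟨2, Nat.prime_two⟩

/-- The coordinate `z₂` of a point of the infinite torus. -/
def coordTwo (x : InfTorus) : ℂ := fourier 1 (x primeTwo)

theorem norm_coordTwo (x : InfTorus) : ‖coordTwo x‖ = 1 :=
  norm_fourier_apply 1 _

theorem measurable_coordTwo : Measurable coordTwo :=
  (fourier 1).continuous.measurable.comp (measurable_pi_apply primeTwo)

theorem torusChar_single_natCast (k : ℕ) (x : InfTorus) :
    torusChar (Finsupp.single primeTwo (k : ℤ)) x = coordTwo x ^ k := by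
  rw [torusChar, Finsupp.prod_single_index (by simp), coordTwo]
  simp [fourier_apply, AddCircle.toCircle_nsmul]

theorem torusChar_single_neg_natCast (k : ℕ) (x : InfTorus) :
    torusChar (Finsupp.single primeTwo (-(k : ℤ))) x = conj (coordTwo x) ^ k := by
  rw [torusChar, Finsupp.prod_single_index (by simp), fourier_neg, ← map_pow,
    ← torusChar_single_natCast, torusChar, Finsupp.prod_single_index (by simp)]

theorem measurePreserving_eval_primeTwo :
    MeasurePreserving (fun x : InfTorus => x primeTwo) infTorusMeasure
      (AddCircle.haarAddCircle : Measure UnitAddCircle) :=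
  measurePreserving_eval_infinitePi _ primeTwo

theorem haarAddCircle_eq_volume :
    (AddCircle.haarAddCircle : Measure UnitAddCircle) = volume := by
  rw [AddCircle.volume_eq_smul_haarAddCircle]; simp

theorem norm_one_sub_fourier_one (t : ℝ) (ht : t ∈ Icc (0 : ℝ) 1) :
    ‖1 - fourier 1 (t : UnitAddCircle)‖ = 2 * Real.sin (Real.pi * t) := by
  have h := Complex.norm_exp_I_mul_ofReal_sub_one (2 * Real.pi * t)
  have hs : 0 ≤ Real.sin (Real.pi * t) :=
    Real.sin_nonneg_of_nonneg_of_le_pi (mul_nonneg Real.pi_pos.le ht.1)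
      (mul_le_of_le_one_right Real.pi_pos.le ht.2)
  rw [show 2 * Real.pi * t / 2 = Real.pi * t by ring, Real.norm_of_nonneg (by positivity)] at h
  rw [fourier_coe_apply, norm_sub_rev, ← h]
  congr 3
  push_cast
  ring

theorem integrable_norm_one_sub_fourier_one_rpow {b : ℝ} (hb0 : 0 ≤ b) (hb1 : b < 1) :
    Integrable (fun y : UnitAddCircle => ‖1 - fourier 1 y‖ ^ (-b)) AddCircle.haarAddCircle := by
  have hmeas : Measurable fun y : UnitAddCircle => ‖1 - fourier 1 y‖ ^ (-b) :=
    ((fourier 1).continuous.measurable.const_sub 1).norm.pow_const _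
  rw [haarAddCircle_eq_volume, ← (UnitAddCircle.measurePreserving_mk 0).map_eq,
    integrable_map_measure hmeas.aestronglyMeasurable
      (UnitAddCircle.measurePreserving_mk 0).aemeasurable, zero_add]
  have h1 : IntervalIntegrable (fun t : ℝ => t ^ (-b)) volume 0 1 :=
    intervalIntegral.intervalIntegrable_rpow' (by linarith)
  have h2 : IntervalIntegrable (fun t : ℝ => (1 - t) ^ (-b)) volume 0 1 := by
    simpa using (h1.comp_sub_left 1).symm
  have h := (intervalIntegrable_iff_integrableOn_Ioo_of_le zero_le_one).mp (h1.add h2)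
  rw [← Measure.restrict_congr_set Ioo_ae_eq_Ioc]
  refine h.mono' (hmeas.comp (UnitAddCircle.measurePreserving_mk 0).measurable).aestronglyMeasurable
    ?_
  filter_upwards [ae_restrict_mem measurableSet_Ioo] with t ht
  have hs := norm_one_sub_fourier_one t ⟨ht.1.le, ht.2.le⟩
  have hpi := Real.pi_pos
  have ht1 : 0 < 1 - t := sub_pos.mpr ht.2
  have e1 : 0 ≤ t ^ (-b) := Real.rpow_nonneg ht.1.le _
  have e2 : 0 ≤ (1 - t) ^ (-b) := Real.rpow_nonneg ht1.le _
  simp only [Function.comp_apply, hs]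
  rw [Real.norm_of_nonneg (Real.rpow_nonneg (hs ▸ norm_nonneg _) _)]
  have key : ∀ y : ℝ, 0 < y → y ≤ 1 / 2 → y ≤ 2 * Real.sin (Real.pi * y) := fun y hy hy2 => by
    have := Real.mul_le_sin (x := Real.pi * y) (by positivity) (by nlinarith)
    have h3 : 2 / Real.pi * (Real.pi * y) = 2 * y := by field_simp
    linarith
  rcases le_total t (1 / 2) with h12 | h12
  · exact (Real.rpow_le_rpow_of_nonpos ht.1 (key t ht.1 h12) (neg_nonpos.mpr hb0)).trans
      (le_add_of_nonneg_right e2)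
  · have h4 := key (1 - t) ht1 (by linarith)
    rw [mul_sub, mul_one, Real.sin_pi_sub] at h4
    exact (Real.rpow_le_rpow_of_nonpos ht1 h4 (neg_nonpos.mpr hb0)).trans
      (le_add_of_nonneg_left e1)

theorem integrable_norm_one_sub_coordTwo_rpow {b : ℝ} (hb0 : 0 ≤ b) (hb1 : b < 1) :
    Integrable (fun x => ‖1 - coordTwo x‖ ^ (-b)) infTorusMeasure :=
  measurePreserving_eval_primeTwo.integrable_comp_of_integrable
    (integrable_norm_one_sub_fourier_one_rpow hb0 hb1)

theorem ae_coordTwo_ne_one : ∀ᵐ x ∂infTorusMeasure, coordTwo x ≠ 1 := by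
  have h : ∀ᵐ y ∂(AddCircle.haarAddCircle : Measure UnitAddCircle), fourier 1 y ≠ (1 : ℂ) := by
    have hmeas : MeasurableSet {y : UnitAddCircle | fourier 1 y ≠ (1 : ℂ)} :=
      ((fourier 1).continuous.measurable (measurableSet_singleton 1)).compl
    rw [haarAddCircle_eq_volume, ← (UnitAddCircle.measurePreserving_mk 0).map_eq,
      ae_map_iff (UnitAddCircle.measurePreserving_mk 0).aemeasurable hmeas, zero_add,
      ← Measure.restrict_congr_set Ioo_ae_eq_Ioc]
    filter_upwards [ae_restrict_mem measurableSet_Ioo] with t ht h1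
    have hs := norm_one_sub_fourier_one t ⟨ht.1.le, ht.2.le⟩
    have hpos : 0 < Real.sin (Real.pi * t) := Real.sin_pos_of_pos_of_lt_pi
      (mul_pos Real.pi_pos ht.1) (mul_lt_of_lt_one_right Real.pi_pos ht.2)
    rw [h1, sub_self, norm_zero] at hs
    linarith
  exact measurePreserving_eval_primeTwo.quasiMeasurePreserving.ae h

/-! ### The symbol and its Bohr lift -/

/-- The function `z ↦ 4 + (1 - z)⁻ᵃ`, which gives the symbol `φ(s) = 4 + (1 - 2⁻ˢ)⁻ᵃ`.
Any constant above `3` in place of `4` makes the norms of `n⁻ᵠ` summable. -/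
def cuspSymbol (a : ℝ) (z : ℂ) : ℂ := 4 + cuspFun a z

theorem differentiableOn_cuspSymbol (a : ℝ) :
    DifferentiableOn ℂ (cuspSymbol a) (Metric.ball 0 1) :=
  (differentiableOn_cuspFun a).const_add 4

theorem hasSum_cuspSymbol (a : ℝ) {z : ℂ} (hz : z ∈ Metric.ball (0 : ℂ) 1) :
    HasSum (fun k => taylorCoeff (cuspSymbol a) k * z ^ k) (cuspSymbol a z) :=
  hasSum_taylorCoeff (differentiableOn_cuspSymbol a) hz

theorem measurable_cuspSymbol (a : ℝ) : Measurable (cuspSymbol a) :=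
  ((measurable_id.const_sub 1).pow_const _).const_add 4

theorem norm_cuspSymbol_le (a : ℝ) (z : ℂ) : ‖cuspSymbol a z‖ ≤ 4 + ‖1 - z‖ ^ (-a) := by
  refine (norm_add_le _ _).trans_eq ?_
  rw [norm_cuspFun]
  norm_num

theorem memLp_cuspSymbol_coordTwo {a q : ℝ} (ha : 0 ≤ a) (hq : 1 ≤ q) (haq : a * q < 1) :
    MemLp (fun x => cuspSymbol a (coordTwo x)) (ENNReal.ofReal q) infTorusMeasure := by
  have hq0 : 0 < q := one_pos.trans_le hq
  have hmeas : Measurable fun x => cuspFun a (coordTwo x) :=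
    (measurable_coordTwo.const_sub 1).pow_const _
  have h : MemLp (fun x => cuspFun a (coordTwo x)) (ENNReal.ofReal q) infTorusMeasure := by
    rw [← integrable_norm_rpow_iff hmeas.aestronglyMeasurable (by simpa using hq0)
      ENNReal.ofReal_ne_top, ENNReal.toReal_ofReal hq0.le]
    refine (integrable_norm_one_sub_coordTwo_rpow (mul_nonneg ha hq0.le) haq).congr
      (ae_of_all _ fun x => ?_)
    simp only [norm_cuspFun]
    rw [← Real.rpow_mul (norm_nonneg _), neg_mul]
  exact (memLp_const (4 : ℂ)).add h

theorem ofReal_mul_coordTwo_mem_ball {r : ℝ} (hr : r ∈ Ioo (0 : ℝ) 1) (x : InfTorus) :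
    (r : ℂ) * coordTwo x ∈ Metric.ball (0 : ℂ) 1 := by
  rw [mem_ball_zero_iff, norm_mul, norm_coordTwo, mul_one, Complex.norm_real,
    Real.norm_of_nonneg hr.1.le]
  exact hr.2

theorem ofReal_mem_ball {r : ℝ} (hr : r ∈ Ioo (0 : ℝ) 1) : (r : ℂ) ∈ Metric.ball (0 : ℂ) 1 := by
  rw [mem_ball_zero_iff, Complex.norm_real, Real.norm_of_nonneg hr.1.le]
  exact hr.2

theorem hasSum_torusFourierCoeff_cuspSymbol_radial (a : ℝ) {r : ℝ} (hr : r ∈ Ioo (0 : ℝ) 1)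
    (α : Nat.Primes →₀ ℤ) :
    HasSum (fun k : ℕ => taylorCoeff (cuspSymbol a) k * (r : ℂ) ^ k *
        if Finsupp.single primeTwo (k : ℤ) = α then 1 else 0)
      (torusFourierCoeff (fun x => cuspSymbol a (r * coordTwo x)) α) := by
  have hG : ∀ x, HasSum (fun k : ℕ => taylorCoeff (cuspSymbol a) k * (r : ℂ) ^ k *
      torusChar (Finsupp.single primeTwo (k : ℤ)) x) (cuspSymbol a (r * coordTwo x)) := fun x => by
    have h := hasSum_cuspSymbol a (ofReal_mul_coordTwo_mem_ball hr x)
    simpa only [mul_pow, ← mul_assoc, torusChar_single_natCast] using h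
  have h := hasSum_integral_mul_torusChar (integrable_torusChar (-α))
    (hasSum_cuspSymbol a (ofReal_mem_ball hr)).summable.norm hG
  simp only [← torusFourierCoeff_torusChar, torusFourierCoeff]
  simpa only [mul_comm (torusChar (-α) _)] using h

theorem one_sub_le_norm_one_sub_mul {w : ℂ} (hw : ‖w‖ = 1) {r : ℝ} (hr : r ∈ Ioo (0 : ℝ) 1) :
    1 - r ≤ ‖1 - r * w‖ := by
  have h := norm_sub_norm_le (1 : ℂ) (r * w)
  rwa [norm_one, norm_mul, hw, mul_one, Complex.norm_real, Real.norm_of_nonneg hr.1.le] at h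

theorem norm_one_sub_le_two_mul {w : ℂ} (hw : ‖w‖ = 1) {r : ℝ} (hr : r ∈ Ioo (0 : ℝ) 1) :
    ‖1 - w‖ ≤ 2 * ‖1 - r * w‖ := by
  have h1 : ‖1 - w‖ ≤ ‖1 - r * w‖ + (1 - r) := by
    have h : 1 - w = (1 - r * w) + ((r - 1 : ℝ) : ℂ) * w := by push_cast; ring
    rw [h]
    refine (norm_add_le _ _).trans_eq ?_
    rw [norm_mul, hw, Complex.norm_real, Real.norm_eq_abs, abs_sub_comm,
      abs_of_pos (sub_pos.mpr hr.2), mul_one]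
  have h2 := one_sub_le_norm_one_sub_mul hw hr
  linarith

theorem one_sub_mem_slitPlane {w : ℂ} (hw : ‖w‖ = 1) (hw1 : w ≠ 1) :
    1 - w ∈ Complex.slitPlane := by
  refine Or.inl ?_
  rw [Complex.sub_re, Complex.one_re, sub_pos]
  refine lt_of_le_of_ne (hw ▸ Complex.re_le_norm w) fun h => hw1 ?_
  have h2 := Complex.sq_norm w
  rw [hw, Complex.normSq_apply, h] at h2
  exact Complex.ext h (by simpa using h2)

theorem tendsto_cuspSymbol_radial (a : ℝ) {w : ℂ} (hw : ‖w‖ = 1) (hw1 : w ≠ 1) :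
    Tendsto (fun r : ℝ => cuspSymbol a (r * w)) (𝓝[<] 1) (𝓝 (cuspSymbol a w)) := by
  have hc : ContinuousAt (fun r : ℝ => cuspSymbol a (r * w)) 1 := by
    unfold cuspSymbol cuspFun
    refine continuousAt_const.add (ContinuousAt.cpow ?_ continuousAt_const ?_)
    · fun_prop
    · simpa using one_sub_mem_slitPlane hw hw1
  have h := hc.tendsto.mono_left (nhdsWithin_le_nhds (s := Iio 1))
  simpa using h

theorem tendsto_torusFourierCoeff_cuspSymbol_radial {a : ℝ} (ha0 : 0 ≤ a) (ha1 : a < 1)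
    (α : Nat.Primes →₀ ℤ) :
    Tendsto (fun r : ℝ => torusFourierCoeff (fun x => cuspSymbol a (r * coordTwo x)) α) (𝓝[<] 1)
      (𝓝 (torusFourierCoeff (fun x => cuspSymbol a (coordTwo x)) α)) := by
  refine tendsto_integral_filter_of_dominated_convergence
    (fun x => 4 + 2 ^ a * ‖1 - coordTwo x‖ ^ (-a)) ?_ ?_ ?_ ?_
  · refine Eventually.of_forall fun r => Measurable.aestronglyMeasurable ?_
    exact ((measurable_cuspSymbol a).comp (measurable_coordTwo.const_mul _)).mul
      (measurable_torusChar _)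
  · filter_upwards [Ioo_mem_nhdsLT one_pos] with r hr
    filter_upwards [ae_coordTwo_ne_one] with x hx
    rw [norm_mul, norm_torusChar, mul_one]
    refine (norm_cuspSymbol_le _ _).trans (add_le_add_right ?_ 4)
    have h0 : 0 < ‖1 - coordTwo x‖ := norm_pos_iff.mpr (sub_ne_zero.mpr hx.symm)
    have h := norm_one_sub_le_two_mul (norm_coordTwo x) hr
    calc ‖1 - r * coordTwo x‖ ^ (-a) ≤ (‖1 - coordTwo x‖ / 2) ^ (-a) :=
          Real.rpow_le_rpow_of_nonpos (by positivity) (by linarith) (neg_nonpos.mpr ha0)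
      _ = 2 ^ a * ‖1 - coordTwo x‖ ^ (-a) := by
          rw [Real.div_rpow h0.le two_pos.le, Real.rpow_neg two_pos.le, div_inv_eq_mul, mul_comm]
  · exact (integrable_const _).add ((integrable_norm_one_sub_coordTwo_rpow ha0 ha1).const_mul _)
  · filter_upwards [ae_coordTwo_ne_one] with x hx
    exact (tendsto_cuspSymbol_radial a (norm_coordTwo x) hx).mul_const _

theorem single_primeTwo_injective :
    Function.Injective fun k : ℕ => (Finsupp.single primeTwo (k : ℤ)) := fun m n h => by
  simpa using Finsupp.single_injective _ h

theorem torusFourierCoeff_cuspSymbol_single {a : ℝ} (ha0 : 0 ≤ a) (ha1 : a < 1) (m : ℕ) :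
    torusFourierCoeff (fun x => cuspSymbol a (coordTwo x)) (Finsupp.single primeTwo (m : ℤ)) =
      taylorCoeff (cuspSymbol a) m := by
  refine tendsto_nhds_unique (tendsto_torusFourierCoeff_cuspSymbol_radial ha0 ha1 _) ?_
  have hlim : Tendsto (fun r : ℝ => taylorCoeff (cuspSymbol a) m * (r : ℂ) ^ m) (𝓝[<] 1)
      (𝓝 (taylorCoeff (cuspSymbol a) m)) := by
    have hc : Continuous fun r : ℝ => taylorCoeff (cuspSymbol a) m * (r : ℂ) ^ m := by fun_prop
    simpa using (hc.tendsto 1).mono_left (nhdsWithin_le_nhds (s := Iio 1))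
  refine hlim.congr' ?_
  filter_upwards [Ioo_mem_nhdsLT one_pos] with r hr
  refine HasSum.unique ?_ (hasSum_torusFourierCoeff_cuspSymbol_radial a hr _)
  have h := hasSum_single (f := fun k : ℕ => taylorCoeff (cuspSymbol a) k * (r : ℂ) ^ k *
      if Finsupp.single primeTwo (k : ℤ) = Finsupp.single primeTwo (m : ℤ) then 1 else 0) m
    fun k hk => by rw [if_neg fun h => hk (single_primeTwo_injective h), mul_zero]
  simpa only [if_true, mul_one] using h

theorem torusFourierCoeff_cuspSymbol_of_ne {a : ℝ} (ha0 : 0 ≤ a) (ha1 : a < 1)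
    {α : Nat.Primes →₀ ℤ} (hα : ∀ m : ℕ, Finsupp.single primeTwo (m : ℤ) ≠ α) :
    torusFourierCoeff (fun x => cuspSymbol a (coordTwo x)) α = 0 := by
  refine tendsto_nhds_unique (tendsto_torusFourierCoeff_cuspSymbol_radial ha0 ha1 _) ?_
  refine tendsto_const_nhds.congr' ?_
  filter_upwards [Ioo_mem_nhdsLT one_pos] with r hr
  refine HasSum.unique ?_ (hasSum_torusFourierCoeff_cuspSymbol_radial a hr α)
  simp [hα, hasSum_zero]

/-- By unique factorisation, `∏ p ^ αₚ` is a power of two only if `α` is supported at `2`. -/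
theorem eq_single_of_prod_pow_eq_two_pow {α : Nat.Primes →₀ ℕ} {m : ℕ}
    (h : (α.prod fun p k => (p : ℕ) ^ k) = 2 ^ m) : α = Finsupp.single primeTwo m := by
  have hsupp : ∀ p ∈ α.support, p = primeTwo := fun p hp => by
    have hdvd : (p : ℕ) ∣ 2 ^ m := by
      rw [← h]
      exact (dvd_pow_self _ (Finsupp.mem_support_iff.mp hp)).trans
        (Finset.dvd_prod_of_mem (fun p : Nat.Primes => (p : ℕ) ^ α p) hp)
    exact Subtype.ext ((Nat.prime_dvd_prime_iff_eq p.2 Nat.prime_two).mp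
      (p.2.dvd_of_dvd_pow hdvd))
  have hα : α = Finsupp.single primeTwo (α primeTwo) :=
    Finsupp.support_subset_singleton.mp fun p hp => Finset.mem_singleton.mpr (hsupp p hp)
  rw [hα, Finsupp.prod_single_index (by simp)] at h
  rw [hα, two_pow_injective h]

theorem isHardyBohrLift_cuspSymbol {a q : ℝ} (ha : 0 ≤ a) (hq : 1 ≤ q) (haq : a * q < 1) :
    IsHardyBohrLift q (twoPowCoeff (taylorCoeff (cuspSymbol a)))
      (fun x => cuspSymbol a (coordTwo x)) := by
  have ha1 : a < 1 := (le_mul_of_one_le_right ha hq).trans_lt haq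
  refine ⟨memLp_cuspSymbol_coordTwo ha hq haq, fun α => ?_, fun α ⟨p, hp⟩ => ?_⟩
  · by_cases h : ∃ m : ℕ, α = Finsupp.single primeTwo m
    · obtain ⟨m, rfl⟩ := h
      rw [Finsupp.mapRange_single, Finsupp.prod_single_index (by simp)]
      exact (torusFourierCoeff_cuspSymbol_single ha ha1 m).trans (twoPowCoeff_two_pow _ m).symm
    · rw [twoPowCoeff_of_notMem _ fun ⟨m, hm⟩ => h ⟨m, eq_single_of_prod_pow_eq_two_pow hm.symm⟩]
      refine torusFourierCoeff_cuspSymbol_of_ne ha ha1 fun m hm => h ⟨m, ?_⟩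
      rw [← Finsupp.mapRange_single (f := fun k : ℕ => (k : ℤ)) (hf := rfl)] at hm
      exact (Finsupp.mapRange_injective _ rfl Nat.cast_injective hm).symm
  · refine torusFourierCoeff_cuspSymbol_of_ne ha ha1 fun m hm => ?_
    rw [← hm, Finsupp.single_apply] at hp
    split_ifs at hp <;> omega

/-! ### The Poisson kernel and the failure of membership -/

/-- The Poisson kernel of the disc at the radius `r`, as a function of the coordinate `z₂`. -/
def poissonTwo (r : ℝ) (x : InfTorus) : ℝ := (1 - r ^ 2) / ‖1 - r * coordTwo x‖ ^ 2

theorem poissonTwo_nonneg {r : ℝ} (hr : r ∈ Ioo (0 : ℝ) 1) (x : InfTorus) : 0 ≤ poissonTwo r x :=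
  div_nonneg (by nlinarith [hr.1, hr.2]) (sq_nonneg _)

theorem measurable_poissonTwo (r : ℝ) : Measurable (poissonTwo r) :=
  (((measurable_coordTwo.const_mul (r : ℂ)).const_sub 1).norm.pow_const 2).const_div _

theorem one_sub_mul_poissonTwo_le {r : ℝ} (hr : r ∈ Ioo (0 : ℝ) 1) (x : InfTorus) :
    (1 - r) * poissonTwo r x ≤ 2 := by
  have h1 := one_sub_le_norm_one_sub_mul (norm_coordTwo x) hr
  have h0 : 0 < 1 - r := sub_pos.mpr hr.2
  rw [poissonTwo, ← mul_div_assoc, div_le_iff₀ (pow_pos (h0.trans_le h1) 2)]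
  calc (1 - r) * (1 - r ^ 2) = (1 + r) * (1 - r) ^ 2 := by ring
    _ ≤ 2 * ‖1 - r * coordTwo x‖ ^ 2 := by
      gcongr
      linarith [hr.2]

theorem tendsto_one_sub_mul_poissonTwo {x : InfTorus} (hx : coordTwo x ≠ 1) :
    Tendsto (fun r => (1 - r) * poissonTwo r x) (𝓝[<] 1) (𝓝 0) := by
  have hc : ContinuousAt (fun r => (1 - r) * poissonTwo r x) 1 := by
    unfold poissonTwo
    refine (continuousAt_const.sub continuousAt_id).mul (ContinuousAt.div₀ (by fun_prop)
      (by fun_prop) ?_)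
    simpa [sub_eq_zero] using hx.symm
  simpa using hc.tendsto.mono_left (nhdsWithin_le_nhds (s := Iio 1))

theorem ofReal_poissonTwo {r : ℝ} (hr : r ∈ Ioo (0 : ℝ) 1) (x : InfTorus) :
    (poissonTwo r x : ℂ) =
      (1 - r * coordTwo x)⁻¹ + (1 - r * conj (coordTwo x))⁻¹ - 1 := by
  have hne : 1 - r * coordTwo x ≠ 0 := fun h => by
    have := one_sub_norm_pos (ofReal_mul_coordTwo_mem_ball hr x)
    rw [h, norm_zero] at this
    exact this.false
  have hconj : 1 - r * conj (coordTwo x) = conj (1 - r * coordTwo x) := by simp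
  have hne' : 1 - r * conj (coordTwo x) ≠ 0 := by
    rw [hconj]
    exact (map_ne_zero _).mpr hne
  have hw : coordTwo x * conj (coordTwo x) = 1 := by
    rw [Complex.mul_conj', norm_coordTwo]
    simp
  rw [poissonTwo]
  push_cast
  rw [← Complex.mul_conj', ← hconj]
  field_simp
  linear_combination (r : ℂ) ^ 2 * hw

theorem hasSum_inv_one_sub_radial {r : ℝ} (hr : r ∈ Ioo (0 : ℝ) 1) (x : InfTorus) :
    HasSum (fun k : ℕ => (r : ℂ) ^ k * torusChar (Finsupp.single primeTwo (k : ℤ)) x)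
      (1 - r * coordTwo x)⁻¹ := by
  simp only [torusChar_single_natCast, ← mul_pow]
  exact hasSum_geometric_of_norm_lt_one
    (mem_ball_zero_iff.mp (ofReal_mul_coordTwo_mem_ball hr x))

theorem hasSum_inv_one_sub_radial_conj {r : ℝ} (hr : r ∈ Ioo (0 : ℝ) 1) (x : InfTorus) :
    HasSum (fun k : ℕ => (r : ℂ) ^ k * torusChar (-Finsupp.single primeTwo (k : ℤ)) x)
      (1 - r * conj (coordTwo x))⁻¹ := by
  simp only [← Finsupp.single_neg, torusChar_single_neg_natCast, ← mul_pow]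
  refine hasSum_geometric_of_norm_lt_one ?_
  rw [norm_mul, RCLike.norm_conj, ← norm_mul]
  exact mem_ball_zero_iff.mp (ofReal_mul_coordTwo_mem_ball hr x)

theorem integrable_mul_poissonTwo {F : InfTorus → ℂ} (hF : Integrable F infTorusMeasure) {r : ℝ}
    (hr : r ∈ Ioo (0 : ℝ) 1) : Integrable (fun x => F x * poissonTwo r x) infTorusMeasure := by
  have h0 : 0 < 1 - r := sub_pos.mpr hr.2
  refine hF.mul_bdd (c := 2 / (1 - r))
    (Complex.measurable_ofReal.comp (measurable_poissonTwo r)).aestronglyMeasurable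
    (ae_of_all _ fun x => ?_)
  rw [Complex.norm_real, Real.norm_of_nonneg (poissonTwo_nonneg hr x), le_div_iff₀' h0]
  exact one_sub_mul_poissonTwo_le hr x

/-- The Poisson integral of an analytic function on the torus, in the variable `z₂`, is the power
series given by its Fourier coefficients at the powers of `z₂`. -/
theorem hasSum_integral_mul_poissonTwo {F : InfTorus → ℂ} (hF : Integrable F infTorusMeasure)
    (hneg : ∀ α : Nat.Primes →₀ ℤ, (∃ p, α p < 0) → torusFourierCoeff F α = 0)
    {r : ℝ} (hr : r ∈ Ioo (0 : ℝ) 1) :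
    HasSum (fun k : ℕ => (r : ℂ) ^ k * torusFourierCoeff F (Finsupp.single primeTwo (k : ℤ)))
      (∫ x, F x * poissonTwo r x ∂infTorusMeasure) := by
  have hsum : Summable fun k : ℕ => ‖(r : ℂ) ^ k‖ :=
    (summable_geometric_of_norm_lt_one (mem_ball_zero_iff.mp (ofReal_mem_ball hr))).norm
  have h1 := hasSum_integral_mul_torusChar hF hsum (hasSum_inv_one_sub_radial hr)
  have h2 := hasSum_integral_mul_torusChar hF hsum (hasSum_inv_one_sub_radial_conj hr)
  have h0 : ∫ x, F x * (1 - r * coordTwo x)⁻¹ ∂infTorusMeasure = ∫ x, F x ∂infTorusMeasure := by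
    have h := hasSum_single (f := fun k : ℕ => (r : ℂ) ^ k *
        ∫ x, F x * torusChar (Finsupp.single primeTwo (k : ℤ)) x ∂infTorusMeasure) 0
      fun k hk => by
        have := hneg (-Finsupp.single primeTwo (k : ℤ)) ⟨primeTwo, by
          simpa using Nat.pos_of_ne_zero hk⟩
        rw [torusFourierCoeff, neg_neg] at this
        rw [this, mul_zero]
    refine (h1.unique h).trans ?_
    simp [torusChar]
  have hbdd : ∀ g : InfTorus → ℂ, Measurable g →
      (∀ x, ‖g x‖ ≤ (1 - r)⁻¹) → Integrable (fun x => F x * g x) infTorusMeasure :=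
    fun g hg hg1 => hF.mul_bdd hg.aestronglyMeasurable (ae_of_all _ hg1)
  have hle : ∀ w : ℂ, ‖w‖ = 1 → ‖(1 - r * w)⁻¹‖ ≤ (1 - r)⁻¹ := fun w hw => by
    rw [norm_inv]
    exact inv_anti₀ (sub_pos.mpr hr.2) (one_sub_le_norm_one_sub_mul hw hr)
  have i1 : Integrable (fun x => F x * (1 - r * coordTwo x)⁻¹) infTorusMeasure :=
    hbdd _ ((measurable_coordTwo.const_mul (r : ℂ)).const_sub 1).inv
    fun x => hle _ (norm_coordTwo x)
  have i2 : Integrable (fun x => F x * (1 - r * conj (coordTwo x))⁻¹) infTorusMeasure :=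
    hbdd _ (((Complex.continuous_conj.measurable.comp measurable_coordTwo).const_mul
    (r : ℂ)).const_sub 1).inv fun x => hle _ ((RCLike.norm_conj _).trans (norm_coordTwo x))
  have hP : ∫ x, F x * poissonTwo r x ∂infTorusMeasure =
      ∫ x, F x * (1 - r * conj (coordTwo x))⁻¹ ∂infTorusMeasure := by
    have h : ∀ x, F x * poissonTwo r x = F x * (1 - r * coordTwo x)⁻¹ +
        F x * (1 - r * conj (coordTwo x))⁻¹ - F x := fun x => by
      rw [ofReal_poissonTwo hr]
      ring
    simp only [h]
    rw [integral_sub (by exact i1.add i2) hF, integral_add i1 i2, h0]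
    ring
  rw [hP]
  exact h2

theorem integral_poissonTwo {r : ℝ} (hr : r ∈ Ioo (0 : ℝ) 1) :
    ∫ x, poissonTwo r x ∂infTorusMeasure = 1 := by
  have h1 : (fun _ : InfTorus => (1 : ℂ)) = torusChar 0 := by
    funext x
    simp [torusChar]
  have hc : ∀ α, torusFourierCoeff (fun _ => 1) α = if 0 = α then 1 else 0 := fun α => by
    rw [h1, torusFourierCoeff_torusChar]
  have h := hasSum_integral_mul_poissonTwo (integrable_const (1 : ℂ)) (fun α ⟨p, hp⟩ => by
    rw [hc, if_neg]
    rintro rfl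
    simp at hp) hr
  have h' := hasSum_single (f := fun k : ℕ => (r : ℂ) ^ k *
      torusFourierCoeff (fun _ => 1) (Finsupp.single primeTwo (k : ℤ))) 0 fun k hk => by
    rw [hc, if_neg, mul_zero]
    intro h
    exact hk (by simpa using (Finsupp.single_eq_zero.mp h.symm))
  have h2 := h.unique h'
  simp only [one_mul, hc, integral_complex_ofReal] at h2
  rw [pow_zero, one_mul, Nat.cast_zero, Finsupp.single_zero, if_pos rfl] at h2
  exact_mod_cast h2

/-- The radial growth `|g(r)| ≥ (1 - r) ^ (-1/p)` is incompatible with boundary values `F` in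
`L^p`: as `g(r)` is the Poisson integral of `F`, these force `(1 - r) |g(r)|^p → 0`. -/
theorem not_isHardyBohrLift_of_growth {p : ℝ} (hp : 1 < p) {b : ℕ → ℂ} {g : ℝ → ℂ}
    (hg : ∀ r ∈ Ioo (0 : ℝ) 1, HasSum (fun k : ℕ => (r : ℂ) ^ k * b (2 ^ k)) (g r))
    (hgrowth : ∀ r ∈ Ioo (0 : ℝ) 1, 1 ≤ (1 - r) ^ p⁻¹ * ‖g r‖) (F : InfTorus → ℂ) :
    ¬ IsHardyBohrLift p b F := by
  rintro ⟨hLp, hpos, hneg⟩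
  have hp0 : 0 < p := one_pos.trans hp
  have hF : Integrable F infTorusMeasure := hLp.integrable (by simpa using hp.le)
  have hFp : Integrable (fun x => ‖F x‖ ^ p) infTorusMeasure := by
    have h := hLp.integrable_norm_rpow (by simpa using hp0) ENNReal.ofReal_ne_top
    rwa [ENNReal.toReal_ofReal hp0.le] at h
  have hcoeff : ∀ k : ℕ, torusFourierCoeff F (Finsupp.single primeTwo (k : ℤ)) = b (2 ^ k) :=
    fun k => by
      have h := hpos (Finsupp.single primeTwo k)
      rwa [Finsupp.mapRange_single, Finsupp.prod_single_index (by simp)] at h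
  have hrepr : ∀ r ∈ Ioo (0 : ℝ) 1, ∫ x, F x * poissonTwo r x ∂infTorusMeasure = g r :=
    fun r hr => by
      have h := hasSum_integral_mul_poissonTwo hF hneg hr
      simp only [hcoeff] at h
      exact h.unique (hg r hr)
  have hbound : ∀ r ∈ Ioo (0 : ℝ) 1, ∀ x, ‖‖F x‖ ^ p * ((1 - r) * poissonTwo r x)‖ ≤
      ‖F x‖ ^ p * 2 := fun r hr x => by
    have h0 : 0 ≤ (1 - r) * poissonTwo r x :=
      mul_nonneg (sub_nonneg.mpr hr.2.le) (poissonTwo_nonneg hr x)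
    rw [Real.norm_of_nonneg (by positivity)]
    gcongr
    exact one_sub_mul_poissonTwo_le hr x
  have hmeas : ∀ r : ℝ, AEStronglyMeasurable
      (fun x => ‖F x‖ ^ p * ((1 - r) * poissonTwo r x)) infTorusMeasure := fun r =>
    hFp.aestronglyMeasurable.mul ((measurable_poissonTwo r).const_mul _).aestronglyMeasurable
  have hlim : Tendsto (fun r => ∫ x, ‖F x‖ ^ p * ((1 - r) * poissonTwo r x) ∂infTorusMeasure)
      (𝓝[<] 1) (𝓝 0) := by
    have h := tendsto_integral_filter_of_dominated_convergence (l := 𝓝[<] (1 : ℝ))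
      (μ := infTorusMeasure) (F := fun r x => ‖F x‖ ^ p * ((1 - r) * poissonTwo r x))
      (f := fun _ => 0) (fun x => ‖F x‖ ^ p * 2) (Eventually.of_forall hmeas)
      (by
        filter_upwards [Ioo_mem_nhdsLT one_pos] with r hr
        exact ae_of_all _ (hbound r hr))
      (hFp.mul_const 2)
      (by
        filter_upwards [ae_coordTwo_ne_one] with x hx
        simpa using (tendsto_one_sub_mul_poissonTwo hx).const_mul (‖F x‖ ^ p))
    simpa using h
  have hmain : ∀ r ∈ Ioo (0 : ℝ) 1, 1 ≤ 1 / 2 +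
      2 ^ (p - 1) * ∫ x, ‖F x‖ ^ p * ((1 - r) * poissonTwo r x) ∂infTorusMeasure := by
    intro r hr
    have hr1 : 0 ≤ 1 - r := sub_nonneg.mpr hr.2.le
    have hPint : Integrable (poissonTwo r) infTorusMeasure :=
      Integrable.of_integral_ne_zero (by rw [integral_poissonTwo hr]; exact one_ne_zero)
    have hUint : Integrable (fun x => ‖F x‖ ^ p * ((1 - r) * poissonTwo r x)) infTorusMeasure :=
      (hFp.mul_const 2).mono' (hmeas r) (ae_of_all _ (hbound r hr))
    -- applied to `u = (1 - r) ^ (1/p) ‖F x‖`, this plays the part of Jensen's inequality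
    have hineq : ∀ u : ℝ, 0 ≤ u → u ≤ 1 / 2 + 2 ^ (p - 1) * u ^ p := fun u hu => by
      rcases le_total u (1 / 2) with h | h
      · exact h.trans (le_add_of_nonneg_right (by positivity))
      · have h1 : 1 ≤ (2 * u) ^ (p - 1) := Real.one_le_rpow (by linarith) (by linarith)
        rw [Real.mul_rpow two_pos.le hu] at h1
        have h2 : u ^ p = u ^ (p - 1) * u := by
          rw [← Real.rpow_add_one (by linarith)]
          ring_nf
        rw [h2, ← mul_assoc]
        nlinarith
    have hpt : ∀ x, (1 - r) ^ p⁻¹ * ‖F x * poissonTwo r x‖ ≤ 1 / 2 * poissonTwo r x +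
        2 ^ (p - 1) * (‖F x‖ ^ p * ((1 - r) * poissonTwo r x)) := fun x => by
      have hP := poissonTwo_nonneg hr x
      have h := hineq ((1 - r) ^ p⁻¹ * ‖F x‖) (by positivity)
      rw [Real.mul_rpow (by positivity) (norm_nonneg _), ← Real.rpow_mul hr1,
        inv_mul_cancel₀ hp0.ne', Real.rpow_one] at h
      rw [norm_mul, Complex.norm_real, Real.norm_of_nonneg hP]
      calc _ = (1 - r) ^ p⁻¹ * ‖F x‖ * poissonTwo r x := by ring
        _ ≤ (1 / 2 + 2 ^ (p - 1) * ((1 - r) * ‖F x‖ ^ p)) * poissonTwo r x := by gcongr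
        _ = _ := by ring
    calc (1 : ℝ) ≤ (1 - r) ^ p⁻¹ * ‖g r‖ := hgrowth r hr
      _ ≤ (1 - r) ^ p⁻¹ * ∫ x, ‖F x * poissonTwo r x‖ ∂infTorusMeasure := by
        rw [← hrepr r hr]
        gcongr
        exact norm_integral_le_integral_norm _
      _ = ∫ x, (1 - r) ^ p⁻¹ * ‖F x * poissonTwo r x‖ ∂infTorusMeasure :=
        (integral_const_mul _ _).symm
      _ ≤ ∫ x, (1 / 2 * poissonTwo r x + 2 ^ (p - 1) *
            (‖F x‖ ^ p * ((1 - r) * poissonTwo r x))) ∂infTorusMeasure :=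
        integral_mono ((integrable_mul_poissonTwo hF hr).norm.const_mul _)
          ((hPint.const_mul _).add (hUint.const_mul _)) hpt
      _ = _ := by
        rw [integral_add (hPint.const_mul _) (hUint.const_mul _), integral_const_mul,
          integral_const_mul, integral_poissonTwo hr, mul_one]
  have hcontra := ge_of_tendsto ((hlim.const_mul (2 ^ (p - 1))).const_add (1 / 2))
    (eventually_of_mem (Ioo_mem_nhdsLT one_pos) hmain)
  norm_num at hcontra

/-! ### The functions `n⁻ᵠ` and the growth of the symbol -/

theorem four_le_re_cuspSymbol {a : ℝ} (ha0 : 0 ≤ a) (ha1 : a < 1) {z : ℂ}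
    (hz : z ∈ Metric.ball (0 : ℂ) 1) : 4 ≤ (cuspSymbol a z).re := by
  have h := le_re_cuspFun ha0 ha1 hz
  have h2 := mul_nonneg (cos_mul_pi_div_two_pos ha0 ha1).le
    (Real.rpow_nonneg (norm_nonneg (1 - z)) (-a))
  simp only [cuspSymbol, Complex.add_re, Complex.re_ofNat]
  linarith

theorem natCast_cpow_neg_cuspSymbol (a : ℝ) {n : ℕ} (hn : n ≠ 0) (z : ℂ) :
    (n : ℂ) ^ (-cuspSymbol a z) =
      ((n : ℂ) ^ 4)⁻¹ * Complex.exp (-Real.log n * cuspFun a z) := by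
  have hn' : (n : ℂ) ≠ 0 := Nat.cast_ne_zero.mpr hn
  rw [cuspSymbol, neg_add, Complex.cpow_add _ _ hn', Complex.cpow_neg,
    Complex.cpow_ofNat, Complex.cpow_def_of_ne_zero hn', Complex.natCast_log]
  ring_nf

/-- The functions `n⁻ᵠ`, `φ(s) = 4 + (1 - 2⁻ˢ)⁻ᵃ`, have summable norms in `𝒜⁺`: the factor `n⁻⁴`
outweighs the norm `O(n²)` of `n ^ (-(1 - 2⁻ˢ)⁻ᵃ)`. -/
theorem exists_wienerAlgebra_natCast_cpow_neg_cuspSymbol {a : ℝ} (ha0 : 0 < a) (ha1 : a < 1) :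
    ∃ u : ℕ → WienerAlgebra, (Summable fun n => ‖u n‖) ∧
      ∀ n ≠ 0, ∀ s : rightHalfPlane, u n s = (n : ℂ) ^ (-cuspSymbol a (2 ^ (-(s : ℂ)))) := by
  obtain ⟨C, hC⟩ := exists_tsum_norm_taylorCoeff_exp_cuspFun_le ha0 ha1
  have h : ∀ n : ℕ, ∃ u : WienerAlgebra, ‖u‖ ≤ C * ((n : ℝ) ^ 2)⁻¹ ∧ (n ≠ 0 →
      ∀ s : rightHalfPlane, u s = (n : ℂ) ^ (-cuspSymbol a (2 ^ (-(s : ℂ))))) := fun n => by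
    rcases eq_or_ne n 0 with rfl | hn
    · exact ⟨0, by simp, fun h => absurd rfl h⟩
    obtain ⟨hs, hle⟩ := hC n hn
    obtain ⟨v, hv, hvs⟩ := WienerAlgebra.exists_of_hasSum hs fun z hz =>
      hasSum_taylorCoeff (differentiableOn_exp_cuspFun a (Real.log n)) hz
    refine ⟨((n : ℂ) ^ 4)⁻¹ • v, ?_, fun _ s => ?_⟩
    · rw [norm_smul, hv, norm_inv, norm_pow, Complex.norm_natCast]
      have hn0 : (0 : ℝ) < n := mod_cast Nat.pos_of_ne_zero hn
      calc _ ≤ ((n : ℝ) ^ 4)⁻¹ * (C * (n : ℝ) ^ 2) := by gcongr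
        _ = C * ((n : ℝ) ^ 2)⁻¹ := by field_simp
    · rw [natCast_cpow_neg_cuspSymbol a hn, ← hvs s]
      rfl
  choose u hu hus using h
  exact ⟨u, Summable.of_nonneg_of_le (fun _ => norm_nonneg _) hu
    ((Real.summable_nat_pow_inv.mpr one_lt_two).mul_left C), hus⟩

theorem one_le_rpow_mul_norm_cuspSymbol {a r : ℝ} (hr : r ∈ Ioo (0 : ℝ) 1) :
    1 ≤ (1 - r) ^ a * ‖cuspSymbol a r‖ := by
  have hr1 : 0 < 1 - r := sub_pos.mpr hr.2
  have hval : cuspFun a r = (((1 - r) ^ (-a) : ℝ) : ℂ) := by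
    rw [cuspFun, Complex.ofReal_cpow hr1.le]
    push_cast
    rfl
  have h : (1 - r) ^ (-a) ≤ ‖cuspSymbol a r‖ := by
    have h := Complex.re_le_norm (cuspSymbol a r)
    rw [cuspSymbol, hval, Complex.add_re, Complex.ofReal_re, Complex.re_ofNat] at h
    rw [cuspSymbol, hval]
    linarith
  calc (1 : ℝ) = (1 - r) ^ a * (1 - r) ^ (-a) := by
        rw [← Real.rpow_add hr1, add_neg_cancel, Real.rpow_zero]
    _ ≤ _ := by gcongr

end

theorem theorem2 (p : ℝ) (hp : 1 < p) :
    ∃ φ : ℂ → ℂ,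
      IsConvergentDirichletSeries φ ∧
      (∀ q : ℝ, 1 ≤ q → q < p → MemDirichletHardy q φ) ∧
      ¬ MemDirichletHardy p φ ∧
      ∃ T : WienerAlgebra →L[ℂ] WienerAlgebra,
        IsCompositionOperator φ T ∧ IsCompactOperator T ∧ IsAbsolutelySumming T := by
  have hp0 : 0 < p := one_pos.trans hp
  have ha0 : 0 < p⁻¹ := inv_pos.mpr hp0
  have ha1 : p⁻¹ < 1 := inv_lt_one_of_one_lt₀ hp
  have hexp : HasDirichletExpansion (fun s => cuspSymbol p⁻¹ (2 ^ (-s)))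
      (twoPowCoeff (taylorCoeff (cuspSymbol p⁻¹))) :=
    HasDirichletExpansion.of_hasSum (differentiableOn_cuspSymbol _) fun _ => hasSum_cuspSymbol _
  obtain ⟨u, hu, hus⟩ := exists_wienerAlgebra_natCast_cpow_neg_cuspSymbol ha0 ha1
  refine ⟨fun s => cuspSymbol p⁻¹ (2 ^ (-s)), ⟨_, hexp⟩, fun q hq hqp => ?_, ?_,
    nuclearOperator WienerAlgebra.coeffCLM u, ?_, ?_, ?_⟩
  · exact ⟨_, hexp, _, isHardyBohrLift_cuspSymbol ha0.le hq (by
      rw [inv_mul_lt_iff₀ hp0, mul_one]; exact hqp)⟩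
  · rintro ⟨b, hb, F, hF⟩
    refine not_isHardyBohrLift_of_growth hp (fun r hr => ?_)
      (fun r hr => one_le_rpow_mul_norm_cuspSymbol hr) F hF
    have h := hasSum_cuspSymbol p⁻¹ (ofReal_mem_ball hr)
    refine h.congr_fun fun k => ?_
    rw [← hexp.unique hb (pow_ne_zero k two_ne_zero), twoPowCoeff_two_pow, mul_comm]
  · exact WienerAlgebra.isCompositionOperator_nuclearOperator (fun s hs =>
      lt_of_lt_of_le four_pos (four_le_re_cuspSymbol ha0.le ha1 (two_cpow_neg_mem_ball hs))) hu hus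
  · exact isCompactOperator_nuclearOperator WienerAlgebra.norm_coeffCLM_le hu
  · exact isAbsolutelySumming_nuclearOperator WienerAlgebra.norm_coeffCLM_le hu
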